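/- Let $t\in\mathbb R\setminus\{0,1,-1\}$ and put $[n]=\frac{t^{2n}-t^{-2n}}{t^2-t^{-2}}$, $[n]!=[1][2]\cdots[n]$. Let $U_t=U_t(su(2))$ be the complex Hopf algebra generated by $e,f,k^{\pm1}$ with relations $kk^{-1}=k^{-1}k=1$, $ke=t^2ek$, $kf=t^{-2}fk$, $[e,f]=\frac{k^2-k^{-2}}{t^2-t^{-2}}$, coproduct $\Delta(k^{\pm1})=k^{\pm1}\otimes k^{\pm1}$, $\Delta(e)=e\otimes k^{-1}+k\otimes e$, $\Delta(f)=f\otimes k^{-1}+k\otimes f$, counit $\varepsilon(k^{\pm1})=1$, $\varepsilon(e)=\varepsilon(f)=0$ and antipode $S(k^{\pm1})=k^{\mp1}$, $S(e)=-t^{-2}e$, $S(f)=-t^2f$. Let $\mathrm{ad}_a(b)=\sum a_{(1)}bS(a_{(2)})$ be its adjoint representation, and for $j\in\frac12\mathbb Z_{\ge0}$ let $(V^j,\pi^j)$ be the $(2j+1)$-dimensional representation with weight basis $e_m$, $m=j,j-1,\dots,-j$, and $$\pi^j(e)e_m=([j-m][j+m+1])^{1/2}e_{m+1},\quad \pi^j(f)e_m=([j+m][j-m+1])^{1/2}e_{m-1},\quad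 \pi^j(k^{\pm1})e_m=t^{\pm2m}e_m .$$ For a natural number $l\ge 0$ and $p=l,l-1,\dots,-l$ let $$\lambda^l_p=\left(\frac{[l+p]!}{[2l]!\,[l-p]!}\right)^{1/2}(\mathrm{ad}_f)^{\,l-p}(e^lk^{-l})\in U_t,$$ and let $U^l\subset U_t$ be the linear span of these elements. Let $(lp,jn\mid jm)_t$ be the Clebsch–Gordan coefficients of the component $V^j$ of $V^l\otimes V^j$: the real numbers such that the $V^j$-part of $e_p\otimes e_n$ is $\sum_m (lp,jn\mid jm)_t\,e^j_m$, where the $e^j_m=\sum_{p,n}(lp,jn\mid jm)_t\,e_p\otimes e_n$ form an orthonormal weight basis of that component (transforming as the $e_m$ above), with the phase fixed by requiring $(ll,j\,(j-l)\mid jj)_t$ to have the sign of $t^{l(l+1)-2(j+1)l}$ (positive for $t>0$); they are $0$ if $V^j$ does not occur, i.e. if $l>2j$. Then $\lambda^l_l,\dots,\lambda^l_{-l}$ are linearly independent, $U^l$ is an irreducible subrepresentation of the adjoint representation, $V^j$ is irreducible, and $\pi^j:U^l\to \mathrm{Hom}(V^j,V^j)$ is an irreducible tensor operator, i.e. $\pi^j(\mathrm{ad}_a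 u)=\sum\pi^j(a_{(1)})\circ\pi^j(u)\circ\pi^j(S(a_{(2)}))$ for all $a\in U_t$, $u\in U^l$. If $l\le 2j$, then for all $p,m,n$ $$\pi^j(\lambda^l_p)_{mn}=\alpha\,(lp,jn\mid jm)_t,\qquad \alpha=t^{l(l+1)}\,[l]!\left(\frac{[2j+l+1]!}{[2l]!\,[2j-l]!\,[2j+1]}\right)^{1/2}.$$ If $l>2j$, then $\pi^j(\lambda^l_p)_{mn}=0=(lp,jn\mid jm)_t$ for all $p,m,n$. -/

import Mathlib

open scoped TensorProduct

noncomputable section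

/-! ## Representations of a Hopf algebra -/

namespace HopfRep

variable {A V W : Type*} [Ring A] [HopfAlgebra ℂ A]
  [AddCommGroup V] [Module ℂ V] [AddCommGroup W] [Module ℂ W]

/-- The adjoint representation of a Hopf algebra on itself: `ad_a (b) = ∑ a₍₁₎ b S(a₍₂₎)`. -/
def ad (A : Type*) [Ring A] [HopfAlgebra ℂ A] : A →ₐ[ℂ] Module.End ℂ A :=
  (Algebra.TensorProduct.lift (Algebra.lmul ℂ A)
    (AlgHom.ofLinearMap ((LinearMap.mul ℂ A).flip ∘ₗ HopfAlgebra.antipode ℂ)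
      (by ext x; simp)
      (fun a b => by
        ext x; simp [HopfAlgebra.antipode_mul_antidistrib, mul_assoc]))
    (fun a b => by
      ext x; simp [mul_assoc])).comp (Bialgebra.comulAlgHom ℂ A)

/-- The representation of a Hopf algebra on `Hom(V, W)`, for representations `π` on `V` and `ρ`
on `W`: `δ(a) f = ∑ ρ(a₍₁₎) ∘ f ∘ π(S(a₍₂₎))`. -/
def homRep (π : A →ₐ[ℂ] Module.End ℂ V) (ρ : A →ₐ[ℂ] Module.End ℂ W) :
    A →ₐ[ℂ] Module.End ℂ (V →ₗ[ℂ] W) :=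
  (Algebra.TensorProduct.lift
    (AlgHom.ofLinearMap (LinearMap.llcomp ℂ V W W ∘ₗ ρ.toLinearMap)
      (by ext f x; simp)
      (fun a b => by ext f x; simp))
    (AlgHom.ofLinearMap
      ((LinearMap.llcomp ℂ V V W).flip ∘ₗ π.toLinearMap ∘ₗ HopfAlgebra.antipode ℂ)
      (by ext f x; simp)
      (fun a b => by ext f x; simp [HopfAlgebra.antipode_mul_antidistrib]))
    (fun a b => by ext f x; simp)).comp (Bialgebra.comulAlgHom ℂ A)

/-- The tensor product of two representations: `a (v ⊗ w) = ∑ a₍₁₎ v ⊗ a₍₂₎ w`. -/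
def tensorRep (π : A →ₐ[ℂ] Module.End ℂ V) (ρ : A →ₐ[ℂ] Module.End ℂ W) :
    A →ₐ[ℂ] Module.End ℂ (V ⊗[ℂ] W) :=
  (Module.endTensorEndAlgHom (R := ℂ) (S := ℂ) (A := ℂ)).comp
    ((Algebra.TensorProduct.map π ρ).comp (Bialgebra.comulAlgHom ℂ A))

/-- The subspace `S` is a nonzero invariant subspace of the representation `σ` and `σ` is
irreducible on it. -/
structure IsIrreducibleOn (σ : A →ₐ[ℂ] Module.End ℂ V) (S : Submodule ℂ V) : Prop where
  ne_bot : S ≠ ⊥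
  invariant : ∀ a, ∀ x ∈ S, σ a x ∈ S
  eq_bot_or_eq : ∀ S' ≤ S, (∀ a, ∀ x ∈ S', σ a x ∈ S') → S' = ⊥ ∨ S' = S

/-- `T : S → Hom(W₁, W₂)` is an irreducible tensor operator, `S` being a subrepresentation of `σ`:
the three representations are irreducible and `T` is a homomorphism of representations. -/
structure IsIrreducibleTensorOperator {W₁ W₂ : Type*} [AddCommGroup W₁] [Module ℂ W₁]
    [AddCommGroup W₂] [Module ℂ W₂]
    (σ : A →ₐ[ℂ] Module.End ℂ V) (S : Submodule ℂ V)
    (ρ₁ : A →ₐ[ℂ] Module.End ℂ W₁) (ρ₂ : A →ₐ[ℂ] Module.End ℂ W₂)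
    (T : S →ₗ[ℂ] (W₁ →ₗ[ℂ] W₂)) : Prop where
  irreducible_type : IsIrreducibleOn σ S
  irreducible_source : IsIrreducibleOn ρ₁ ⊤
  irreducible_target : IsIrreducibleOn ρ₂ ⊤
  equivariant : ∀ (a : A) (x y : S), (y : V) = σ a x → T y = homRep ρ₁ ρ₂ a (T x)

end HopfRep

/-! ## The quantum algebra `U_t(su(2))`, `t` real and nonzero -/

namespace QuantumSU2

/-- The generators `e`, `f`, `k`, `k⁻¹`. -/
inductive Gen
  | e
  | f
  | k
  | kinv

/-- The defining relations. -/
inductive Rel (t : ℝˣ) : FreeAlgebra ℂ Gen → FreeAlgebra ℂ Gen → Prop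
  | k_kinv : Rel t (FreeAlgebra.ι ℂ Gen.k * FreeAlgebra.ι ℂ Gen.kinv) 1
  | kinv_k : Rel t (FreeAlgebra.ι ℂ Gen.kinv * FreeAlgebra.ι ℂ Gen.k) 1
  | k_e : Rel t (FreeAlgebra.ι ℂ Gen.k * FreeAlgebra.ι ℂ Gen.e)
      (((t : ℝ) : ℂ) ^ (2 : ℤ) • (FreeAlgebra.ι ℂ Gen.e * FreeAlgebra.ι ℂ Gen.k))
  | k_f : Rel t (FreeAlgebra.ι ℂ Gen.k * FreeAlgebra.ι ℂ Gen.f)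
      (((t : ℝ) : ℂ) ^ (-2 : ℤ) • (FreeAlgebra.ι ℂ Gen.f * FreeAlgebra.ι ℂ Gen.k))
  | e_f : Rel t (FreeAlgebra.ι ℂ Gen.e * FreeAlgebra.ι ℂ Gen.f
        - FreeAlgebra.ι ℂ Gen.f * FreeAlgebra.ι ℂ Gen.e)
      ((((t : ℝ) : ℂ) ^ (2 : ℤ) - ((t : ℝ) : ℂ) ^ (-2 : ℤ))⁻¹ •
        (FreeAlgebra.ι ℂ Gen.k ^ 2 - FreeAlgebra.ι ℂ Gen.kinv ^ 2))

/-- The algebra `U_t(su(2))`, that is the complex algebra `U_t(sl(2))` for real `t`. -/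
def U (t : ℝˣ) : Type := RingQuot (Rel t)

instance instRing (t : ℝˣ) : Ring (U t) := inferInstanceAs (Ring (RingQuot (Rel t)))

instance instAlgebra (t : ℝˣ) : Algebra ℂ (U t) := inferInstanceAs (Algebra ℂ (RingQuot (Rel t)))

/-- The quotient map from the free algebra. -/
def mk (t : ℝˣ) : FreeAlgebra ℂ Gen →ₐ[ℂ] U t := RingQuot.mkAlgHom ℂ (Rel t)

lemma mk_rel {t : ℝˣ} {x y : FreeAlgebra ℂ Gen} (h : Rel t x y) : mk t x = mk t y :=
  RingQuot.mkAlgHom_rel ℂ h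

variable {t : ℝˣ}

/-- The image of a generator in `U t`. -/
def gen (t : ℝˣ) (g : Gen) : U t := mk t (FreeAlgebra.ι ℂ g)

/-- The generator `e`. -/
def e (t : ℝˣ) : U t := gen t Gen.e
/-- The generator `f`. -/
def f (t : ℝˣ) : U t := gen t Gen.f
/-- The generator `k`. -/
def k (t : ℝˣ) : U t := gen t Gen.k
/-- The generator `k⁻¹`. -/
def kinv (t : ℝˣ) : U t := gen t Gen.kinv

lemma k_mul_kinv : k t * kinv t = 1 := by
  simpa [k, kinv, gen] using mk_rel (Rel.k_kinv (t := t))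

lemma kinv_mul_k : kinv t * k t = 1 := by
  simpa [k, kinv, gen] using mk_rel (Rel.kinv_k (t := t))

lemma k_mul_e : k t * e t = ((t : ℝ) : ℂ) ^ (2 : ℤ) • (e t * k t) := by
  simpa only [map_mul, map_smul, e, f, k, kinv, gen] using mk_rel (Rel.k_e (t := t))

lemma k_mul_f : k t * f t = ((t : ℝ) : ℂ) ^ (-2 : ℤ) • (f t * k t) := by
  simpa only [map_mul, map_smul, e, f, k, kinv, gen] using mk_rel (Rel.k_f (t := t))

lemma e_mul_f : e t * f t - f t * e t =
    (((t : ℝ) : ℂ) ^ (2 : ℤ) - ((t : ℝ) : ℂ) ^ (-2 : ℤ))⁻¹ • (k t ^ 2 - kinv t ^ 2) := by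
  simpa only [map_mul, map_smul, map_sub, map_pow, e, f, k, kinv, gen] using mk_rel (Rel.e_f (t := t))

/-- The universal property of `U t`. -/
def lift {B : Type*} [Ring B] [Algebra ℂ B] (E F K K' : B)
    (h₁ : K * K' = 1) (h₂ : K' * K = 1)
    (h₃ : K * E = ((t : ℝ) : ℂ) ^ (2 : ℤ) • (E * K))
    (h₄ : K * F = ((t : ℝ) : ℂ) ^ (-2 : ℤ) • (F * K))
    (h₅ : E * F - F * E =
      (((t : ℝ) : ℂ) ^ (2 : ℤ) - ((t : ℝ) : ℂ) ^ (-2 : ℤ))⁻¹ • (K ^ 2 - K' ^ 2)) :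
    U t →ₐ[ℂ] B :=
  (RingQuot.liftAlgHom ℂ ⟨FreeAlgebra.lift ℂ (fun g => match g with
    | Gen.e => E
    | Gen.f => F
    | Gen.k => K
    | Gen.kinv => K'), by
      intro x y h
      induction h with
      | k_kinv => simpa using h₁
      | kinv_k => simpa using h₂
      | k_e => simpa only [map_mul, map_smul, FreeAlgebra.lift_ι_apply] using h₃
      | k_f => simpa only [map_mul, map_smul, FreeAlgebra.lift_ι_apply] using h₄
      | e_f => simpa only [map_mul, map_smul, map_sub, map_pow, FreeAlgebra.lift_ι_apply] using h₅⟩ :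
    RingQuot (Rel t) →ₐ[ℂ] B)

section lift
variable {B : Type*} [Ring B] [Algebra ℂ B] {E F K K' : B}
    {h₁ : K * K' = 1} {h₂ : K' * K = 1}
    {h₃ : K * E = ((t : ℝ) : ℂ) ^ (2 : ℤ) • (E * K)}
    {h₄ : K * F = ((t : ℝ) : ℂ) ^ (-2 : ℤ) • (F * K)}
    {h₅ : E * F - F * E =
      (((t : ℝ) : ℂ) ^ (2 : ℤ) - ((t : ℝ) : ℂ) ^ (-2 : ℤ))⁻¹ • (K ^ 2 - K' ^ 2)}

@[simp] lemma lift_e : lift (t := t) E F K K' h₁ h₂ h₃ h₄ h₅ (e t) = E :=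
  (RingQuot.liftAlgHom_mkAlgHom_apply ℂ _ _ _).trans (FreeAlgebra.lift_ι_apply _ _)
@[simp] lemma lift_f : lift (t := t) E F K K' h₁ h₂ h₃ h₄ h₅ (f t) = F :=
  (RingQuot.liftAlgHom_mkAlgHom_apply ℂ _ _ _).trans (FreeAlgebra.lift_ι_apply _ _)
@[simp] lemma lift_k : lift (t := t) E F K K' h₁ h₂ h₃ h₄ h₅ (k t) = K :=
  (RingQuot.liftAlgHom_mkAlgHom_apply ℂ _ _ _).trans (FreeAlgebra.lift_ι_apply _ _)
@[simp] lemma lift_kinv : lift (t := t) E F K K' h₁ h₂ h₃ h₄ h₅ (kinv t) = K' :=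
  (RingQuot.liftAlgHom_mkAlgHom_apply ℂ _ _ _).trans (FreeAlgebra.lift_ι_apply _ _)
end lift

lemma algHom_ext {B : Type*} [Semiring B] [Algebra ℂ B] {φ ψ : U t →ₐ[ℂ] B}
    (he : φ (e t) = ψ (e t)) (hf : φ (f t) = ψ (f t)) (hk : φ (k t) = ψ (k t))
    (hk' : φ (kinv t) = ψ (kinv t)) : φ = ψ := by
  refine RingQuot.ringQuot_ext' (S := ℂ) (s := Rel t) (B := B) φ ψ ?_
  apply FreeAlgebra.hom_ext
  funext g
  cases g
  · exact he
  · exact hf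
  · exact hk
  · exact hk'

lemma t_ne (t : ℝˣ) : ((t : ℝ) : ℂ) ≠ 0 := by exact_mod_cast t.ne_zero

lemma t_zpow (t : ℝˣ) :
    ((t : ℝ) : ℂ) ^ (2 : ℤ) * ((t : ℝ) : ℂ) ^ (-2 : ℤ) = 1 := by
  rw [← zpow_add₀ (t_ne t)]; simp

lemma kinv_mul_e : kinv t * e t = ((t : ℝ) : ℂ) ^ (-2 : ℤ) • (e t * kinv t) := by
  have h : kinv t * (k t * e t) * kinv t =
      kinv t * (((t : ℝ) : ℂ) ^ (2 : ℤ) • (e t * k t)) * kinv t := by rw [k_mul_e]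
  rw [← mul_assoc, kinv_mul_k, one_mul, mul_smul_comm, smul_mul_assoc, mul_assoc (kinv t),
    mul_assoc (e t), k_mul_kinv, mul_one] at h
  rw [h, smul_smul, mul_comm, t_zpow, one_smul]

lemma kinv_mul_f : kinv t * f t = ((t : ℝ) : ℂ) ^ (2 : ℤ) • (f t * kinv t) := by
  have h : kinv t * (k t * f t) * kinv t =
      kinv t * (((t : ℝ) : ℂ) ^ (-2 : ℤ) • (f t * k t)) * kinv t := by rw [k_mul_f]
  rw [← mul_assoc, kinv_mul_k, one_mul, mul_smul_comm, smul_mul_assoc, mul_assoc (kinv t),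
    mul_assoc (f t), k_mul_kinv, mul_one] at h
  rw [h, smul_smul, t_zpow, one_smul]

/-- The coproduct: `Δ(e) = e ⊗ k⁻¹ + k ⊗ e`, `Δ(f) = f ⊗ k⁻¹ + k ⊗ f`, `Δ(k^{±1}) = k^{±1} ⊗ k^{±1}`. -/
def Δ (t : ℝˣ) : U t →ₐ[ℂ] U t ⊗[ℂ] U t :=
  lift (t := t) (e t ⊗ₜ[ℂ] kinv t + k t ⊗ₜ[ℂ] e t) (f t ⊗ₜ[ℂ] kinv t + k t ⊗ₜ[ℂ] f t)
    (k t ⊗ₜ[ℂ] k t) (kinv t ⊗ₜ[ℂ] kinv t)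
    (by simp [k_mul_kinv, Algebra.TensorProduct.one_def])
    (by simp [kinv_mul_k, Algebra.TensorProduct.one_def])
    (by
      simp only [mul_add, add_mul, Algebra.TensorProduct.tmul_mul_tmul, k_mul_e, k_mul_kinv,
        kinv_mul_k, smul_add, TensorProduct.smul_tmul', TensorProduct.tmul_smul])
    (by
      simp only [mul_add, add_mul, Algebra.TensorProduct.tmul_mul_tmul, k_mul_f, k_mul_kinv,
        kinv_mul_k, smul_add, TensorProduct.smul_tmul', TensorProduct.tmul_smul])
    (by
      have h := e_mul_f (t := t)
      have h' : e t * f t = f t * e t + (((t : ℝ) : ℂ) ^ (2 : ℤ) - ((t : ℝ) : ℂ) ^ (-2 : ℤ))⁻¹ •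
        (k t ^ 2 - kinv t ^ 2) := by rw [← h]; abel
      simp only [mul_add, add_mul, Algebra.TensorProduct.tmul_mul_tmul, pow_two, h', k_mul_e,
        k_mul_f, kinv_mul_e, kinv_mul_f, smul_sub, TensorProduct.smul_tmul',
        TensorProduct.tmul_smul, TensorProduct.add_tmul, TensorProduct.tmul_add,
        TensorProduct.sub_tmul, TensorProduct.tmul_sub]
      abel)

/-- The counit. -/
def ε (t : ℝˣ) : U t →ₐ[ℂ] ℂ :=
  lift (t := t) 0 0 1 1 (by simp) (by simp) (by simp) (by simp) (by simp)

/-- The antipode, as an algebra homomorphism to the opposite algebra: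
`S(e) = -t⁻² e`, `S(f) = -t² f`, `S(k^{±1}) = k^{∓1}`. -/
def S (t : ℝˣ) : U t →ₐ[ℂ] (U t)ᵐᵒᵖ :=
  lift (t := t) (MulOpposite.op (-(((t : ℝ) : ℂ) ^ (-2 : ℤ) • e t)))
    (MulOpposite.op (-(((t : ℝ) : ℂ) ^ (2 : ℤ) • f t)))
    (MulOpposite.op (kinv t)) (MulOpposite.op (k t))
    (by rw [← MulOpposite.op_mul, k_mul_kinv, MulOpposite.op_one])
    (by rw [← MulOpposite.op_mul, kinv_mul_k, MulOpposite.op_one])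
    (by
      apply MulOpposite.unop_injective
      simp only [MulOpposite.unop_mul, MulOpposite.unop_smul, MulOpposite.unop_op, neg_mul,
        mul_neg, smul_mul_assoc, mul_smul_comm, kinv_mul_e, smul_neg, smul_smul]
      rw [← mul_assoc, t_zpow, one_mul])
    (by
      apply MulOpposite.unop_injective
      simp only [MulOpposite.unop_mul, MulOpposite.unop_smul, MulOpposite.unop_op, neg_mul,
        mul_neg, smul_mul_assoc, mul_smul_comm, kinv_mul_f, smul_neg, smul_smul]
      rw [mul_comm, mul_assoc, t_zpow, mul_one])
    (by
      apply MulOpposite.unop_injective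
      simp only [MulOpposite.unop_mul, MulOpposite.unop_smul, MulOpposite.unop_op,
        MulOpposite.unop_sub, MulOpposite.unop_pow, neg_mul,
        mul_neg, smul_mul_assoc, mul_smul_comm, neg_neg, smul_neg, smul_smul]
      rw [t_zpow, mul_comm (((t : ℝ) : ℂ) ^ (-2 : ℤ)), t_zpow, one_smul, one_smul,
        ← neg_sub (e t * f t), e_mul_f, ← smul_neg, neg_sub])

instance instBialgebra (t : ℝˣ) : Bialgebra ℂ (U t) :=
  Bialgebra.ofAlgHom (Δ t) (ε t)
    (by
      apply algHom_ext <;>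
      simp [Δ, TensorProduct.add_tmul, TensorProduct.tmul_add, add_assoc])
    (by apply algHom_ext <;> simp [Δ, ε])
    (by apply algHom_ext <;> simp [Δ, ε])

lemma comul_eq (x : U t) : Coalgebra.comul (R := ℂ) x = Δ t x := rfl

lemma counit_eq (x : U t) : Coalgebra.counit (R := ℂ) x = ε t x := rfl

/-- An induction principle for elements of `U t`. -/
lemma U_induction {P : U t → Prop} (hc : ∀ c : ℂ, P (algebraMap ℂ (U t) c))
    (he : P (e t)) (hf : P (f t)) (hk : P (k t)) (hk' : P (kinv t))
    (hadd : ∀ a b, P a → P b → P (a + b)) (hmul : ∀ a b, P a → P b → P (a * b)) (a : U t) :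
    P a := by
  obtain ⟨x, rfl⟩ : ∃ x, mk t x = a := RingQuot.mkAlgHom_surjective ℂ (Rel t) a
  induction x using FreeAlgebra.induction with
  | grade0 c => rw [AlgHom.commutes]; exact hc c
  | grade1 g =>
    cases g
    · exact he
    · exact hf
    · exact hk
    · exact hk'
  | mul x y hx hy => rw [map_mul]; exact hmul _ _ hx hy
  | add x y hx hy => rw [map_add]; exact hadd _ _ hx hy

/-- The antipode as a linear map. -/
def antipode (t : ℝˣ) : U t →ₗ[ℂ] U t :=
  (MulOpposite.opLinearEquiv ℂ).symm.toLinearMap ∘ₗ (S t).toLinearMap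

lemma antipode_mul (a b : U t) : antipode t (a * b) = antipode t b * antipode t a := by
  simp [antipode]

lemma antipode_algebraMap (c : ℂ) :
    antipode t (algebraMap ℂ (U t) c) = algebraMap ℂ (U t) c := by
  simp [antipode]

lemma antipode_one : antipode t 1 = 1 := by simp [antipode]

lemma antipode_e : antipode t (e t) = -(((t : ℝ) : ℂ) ^ (-2 : ℤ) • e t) := by
  simp [antipode, S]
lemma antipode_f : antipode t (f t) = -(((t : ℝ) : ℂ) ^ (2 : ℤ) • f t) := by
  simp [antipode, S]
lemma antipode_k : antipode t (k t) = kinv t := by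
  simp [antipode, S]
lemma antipode_kinv : antipode t (kinv t) = k t := by
  simp [antipode, S]

lemma rTensor_mul (x y : U t ⊗[ℂ] U t) (c : ℂ)
    (hx : LinearMap.mul' ℂ (U t) ((antipode t).rTensor (U t) x) = algebraMap ℂ (U t) c) :
    LinearMap.mul' ℂ (U t) ((antipode t).rTensor (U t) (x * y)) =
      algebraMap ℂ (U t) c * LinearMap.mul' ℂ (U t) ((antipode t).rTensor (U t) y) := by
  induction y with
  | zero => simp
  | add y z hy hz => simp only [mul_add, map_add, hy, hz]
  | tmul y₁ y₂ =>
    have key : LinearMap.mul' ℂ (U t) ((antipode t).rTensor (U t) (x * (y₁ ⊗ₜ[ℂ] y₂))) =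
        antipode t y₁ * LinearMap.mul' ℂ (U t) ((antipode t).rTensor (U t) x) * y₂ := by
      clear hx
      induction x with
      | zero => simp
      | add x z hx hz => simp only [mul_add, add_mul, map_add, hx, hz]
      | tmul x₁ x₂ => simp [antipode_mul, mul_assoc]
    rw [key, hx, ← Algebra.commutes c (antipode t y₁)]
    simp [mul_assoc]

lemma lTensor_mul (x y : U t ⊗[ℂ] U t) (c : ℂ)
    (hy : LinearMap.mul' ℂ (U t) ((antipode t).lTensor (U t) y) = algebraMap ℂ (U t) c) :
    LinearMap.mul' ℂ (U t) ((antipode t).lTensor (U t) (x * y)) =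
      LinearMap.mul' ℂ (U t) ((antipode t).lTensor (U t) x) * algebraMap ℂ (U t) c := by
  induction x with
  | zero => simp
  | add x z hx hz => simp only [add_mul, map_add, hx, hz]
  | tmul x₁ x₂ =>
    have key : LinearMap.mul' ℂ (U t) ((antipode t).lTensor (U t) ((x₁ ⊗ₜ[ℂ] x₂) * y)) =
        x₁ * LinearMap.mul' ℂ (U t) ((antipode t).lTensor (U t) y) * antipode t x₂ := by
      clear hy
      induction y with
      | zero => simp
      | add y z hy hz => simp only [mul_add, add_mul, map_add, hy, hz]
      | tmul y₁ y₂ => simp [antipode_mul, mul_assoc]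
    rw [key, hy, mul_assoc, Algebra.commutes c (antipode t x₂), ← mul_assoc]
    simp

/-- The Hopf algebra `U_t(su(2))`. -/
instance instHopfAlgebra (t : ℝˣ) : HopfAlgebra ℂ (U t) where
  antipode := antipode t
  mul_antipode_rTensor_comul := by
    ext a
    simp only [LinearMap.comp_apply, comul_eq, counit_eq, Algebra.linearMap_apply]
    induction a using U_induction with
    | hc c => simp [Algebra.TensorProduct.algebraMap_apply, antipode_algebraMap]
    | he => simp [Δ, ε, antipode_e, antipode_k, kinv_mul_e]
    | hf => simp [Δ, ε, antipode_f, antipode_k, kinv_mul_f]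
    | hk => simp [Δ, ε, antipode_k, kinv_mul_k]
    | hk' => simp [Δ, ε, antipode_kinv, k_mul_kinv]
    | hadd a b ha hb => simp only [map_add, ha, hb]
    | hmul a b ha hb => rw [map_mul, rTensor_mul _ _ _ ha, hb, ← map_mul, ← map_mul]
  mul_antipode_lTensor_comul := by
    ext a
    simp only [LinearMap.comp_apply, comul_eq, counit_eq, Algebra.linearMap_apply]
    induction a using U_induction with
    | hc c => simp [Algebra.TensorProduct.algebraMap_apply, antipode_one]
    | he =>
      simp [Δ, ε, antipode_e, antipode_kinv, k_mul_e, smul_smul, t_ne t]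
    | hf =>
      simp [Δ, ε, antipode_f, antipode_kinv, k_mul_f, smul_smul, t_ne t]
    | hk => simp [Δ, ε, antipode_k, k_mul_kinv]
    | hk' => simp [Δ, ε, antipode_kinv, kinv_mul_k]
    | hadd a b ha hb => simp only [map_add, ha, hb]
    | hmul a b ha hb => rw [map_mul, lTensor_mul _ _ _ hb, ha, ← map_mul, ← map_mul]

/-! ### `q`-numbers and the irreducible representations -/

/-- `[n] = (t^{2n} - t^{-2n}) / (t² - t⁻²)`. -/
def qnum (t : ℝˣ) (n : ℤ) : ℝ :=
  ((t : ℝ) ^ (2 * n) - (t : ℝ) ^ (-(2 * n))) / ((t : ℝ) ^ (2 : ℤ) - (t : ℝ) ^ (-2 : ℤ))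

/-- `[n]! = [1][2]⋯[n]`. -/
def qfact (t : ℝˣ) (n : ℕ) : ℝ := ∏ i ∈ Finset.range n, qnum t (i + 1)

/-- The underlying space of the irreducible representation `V^j`, where `N = 2j`. The weight basis
vector `e_m`, `m = j, j - 1, …, -j`, is the standard basis vector with index `j - m ∈ {0, …, 2j}`. -/
abbrev V (N : ℕ) : Type := Fin (N + 1) → ℂ

/-- The weight basis vector `e_m` of `V^j`, with `N = 2j` and `s = j - m`. -/
def wt (N : ℕ) (s : Fin (N + 1)) : V N := Pi.single s 1

/-- Matrix of `e`: `e e_m = ([j-m][j+m+1])^{1/2} e_{m+1}`; here `N = 2j`, `b = j - m`. -/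
def eMat (t : ℝˣ) (N : ℕ) : Matrix (Fin (N + 1)) (Fin (N + 1)) ℂ :=
  Matrix.of fun a b => if (a : ℕ) + 1 = b then
    ((Real.sqrt (qnum t b * qnum t (N - b + 1)) : ℝ) : ℂ) else 0

/-- Matrix of `f`: `f e_m = ([j+m][j-m+1])^{1/2} e_{m-1}`; here `N = 2j`, `b = j - m`. -/
def fMat (t : ℝˣ) (N : ℕ) : Matrix (Fin (N + 1)) (Fin (N + 1)) ℂ :=
  Matrix.of fun a b => if (a : ℕ) = b + 1 then
    ((Real.sqrt (qnum t (N - b) * qnum t (b + 1)) : ℝ) : ℂ) else 0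

/-- Matrix of `k` (`σ = 1`) and of `k⁻¹` (`σ = -1`): `k^σ e_m = t^{2σm} e_m`; here `N = 2j` and
`b = j - m`, so that `2m = N - 2b`. -/
def kMat (t : ℝˣ) (N : ℕ) (σ : ℤ) : Matrix (Fin (N + 1)) (Fin (N + 1)) ℂ :=
  Matrix.diagonal fun b => ((t : ℝ) : ℂ) ^ (σ * ((N : ℤ) - 2 * (b : ℤ)))

lemma qnum_nonneg (t : ℝˣ) (n : ℕ) : 0 ≤ qnum t n := by
  have ht : (t : ℝ) ≠ 0 := t.ne_zero
  set x : ℝ := (t : ℝ) ^ (2 : ℤ) with hx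
  have hx0 : 0 < x := by positivity
  have h1 : (t : ℝ) ^ (2 * (n : ℤ)) = x ^ n := by rw [zpow_mul, zpow_natCast]
  have h2 : (t : ℝ) ^ (-(2 * (n : ℤ))) = (x ^ n)⁻¹ := by rw [zpow_neg, h1]
  have h3 : (t : ℝ) ^ (-2 : ℤ) = x⁻¹ := by rw [zpow_neg]
  rw [qnum, h1, h2, h3, ← hx]
  rcases le_total 1 x with h | h
  · have a1 : (x ^ n)⁻¹ ≤ x ^ n := (inv_le_one_of_one_le₀ (one_le_pow₀ h)).trans (one_le_pow₀ h)
    have a2 : x⁻¹ ≤ x := (inv_le_one_of_one_le₀ h).trans h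
    exact div_nonneg (by linarith) (by linarith)
  · have b1 : x ^ n ≤ 1 := pow_le_one₀ hx0.le h
    have a1 : x ^ n ≤ (x ^ n)⁻¹ := b1.trans ((one_le_inv₀ (by positivity)).2 b1)
    have a2 : x ≤ x⁻¹ := h.trans ((one_le_inv₀ hx0).2 h)
    exact div_nonneg_of_nonpos (by linarith) (by linarith)

lemma eMat_mul_fMat_apply (t : ℝˣ) (N : ℕ) (a b : Fin (N + 1)) :
    (eMat t N * fMat t N) a b =
      if a = b then ((qnum t (a + 1) * qnum t (N - a) : ℝ) : ℂ) else 0 := by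
  rw [Matrix.mul_apply]
  by_cases ha : (a : ℕ) < N
  · rw [Finset.sum_eq_single (⟨a + 1, by omega⟩ : Fin (N + 1))]
    · by_cases hab : a = b
      · subst hab
        have h1 := qnum_nonneg t (a + 1)
        have h2 := qnum_nonneg t (N - a)
        rw [Nat.cast_sub ha.le] at h2
        push_cast at h1
        simp only [eMat, fMat, Matrix.of_apply, if_true]
        rw [← Complex.ofReal_mul]
        congr 1
        push_cast
        rw [show (N : ℤ) - ((a : ℕ) + 1 : ℤ) + 1 = N - (a : ℕ) by ring,
          mul_comm (qnum t (N - (a : ℕ))), Real.mul_self_sqrt (mul_nonneg h1 h2)]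
      · have hab' : (a : ℕ) ≠ b := fun h => hab (Fin.ext h)
        simp [eMat, fMat, hab, hab']
    · intro c _ hc
      have : ¬ ((a : ℕ) + 1 = c) := fun h => hc (Fin.ext h.symm)
      simp [eMat, this]
    · simp
  · have haN : (a : ℕ) = N := by omega
    rw [Finset.sum_eq_zero]
    · simp [haN, qnum]
    · intro c _
      have : ¬ ((a : ℕ) + 1 = c) := by omega
      simp [eMat, this]

lemma fMat_mul_eMat_apply (t : ℝˣ) (N : ℕ) (a b : Fin (N + 1)) :
    (fMat t N * eMat t N) a b =
      if a = b then ((qnum t a * qnum t (N - a + 1) : ℝ) : ℂ) else 0 := by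
  rw [Matrix.mul_apply]
  by_cases ha : 0 < (a : ℕ)
  · rw [Finset.sum_eq_single (⟨a - 1, by omega⟩ : Fin (N + 1))]
    · by_cases hab : a = b
      · subst hab
        have h1 := qnum_nonneg t a
        have h2 := qnum_nonneg t (N - a + 1 : ℕ)
        rw [Nat.cast_add, Nat.cast_sub (by omega)] at h2
        push_cast at h2
        have h3 : (a : ℕ) - 1 + 1 = a := by omega
        have h4 : (((a : ℕ) - 1 : ℕ) : ℤ) = (a : ℕ) - 1 := by omega
        simp only [eMat, fMat, Matrix.of_apply, h3, if_true, h4]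
        rw [← Complex.ofReal_mul]
        congr 1
        rw [show (N : ℤ) - ((a : ℕ) - 1 : ℤ) = N - (a : ℕ) + 1 by ring,
          show ((a : ℕ) - 1 + 1 : ℤ) = (a : ℕ) by ring,
          mul_comm (qnum t (N - (a : ℕ) + 1)), Real.mul_self_sqrt (mul_nonneg h1 h2)]
      · have hab' : ¬ ((a : ℕ) - 1 + 1 = b) := fun h => hab (Fin.ext (by omega))
        simp [eMat, fMat, hab, hab']
    · intro c _ hc
      have : ¬ ((a : ℕ) = c + 1) := fun h => hc (Fin.ext (by simp; omega))
      simp [fMat, this]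
    · simp
  · have ha0 : (a : ℕ) = 0 := by omega
    rw [Finset.sum_eq_zero]
    · simp [ha0, qnum]
    · intro c _
      have : ¬ ((a : ℕ) = c + 1) := by omega
      simp [fMat, this]

lemma qnum_identity (t : ℝˣ) (N a : ℤ) :
    qnum t (a + 1) * qnum t (N - a) - qnum t a * qnum t (N - a + 1) =
      ((t : ℝ) ^ (2 : ℤ) - (t : ℝ) ^ (-2 : ℤ))⁻¹ *
        ((t : ℝ) ^ (2 * (N - 2 * a)) - (t : ℝ) ^ (-(2 * (N - 2 * a)))) := by
  have ht : (t : ℝ) ≠ 0 := t.ne_zero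
  have key : ((t : ℝ) ^ (2 * (a + 1)) - (t : ℝ) ^ (-(2 * (a + 1)))) *
        ((t : ℝ) ^ (2 * (N - a)) - (t : ℝ) ^ (-(2 * (N - a)))) -
      ((t : ℝ) ^ (2 * a) - (t : ℝ) ^ (-(2 * a))) *
        ((t : ℝ) ^ (2 * (N - a + 1)) - (t : ℝ) ^ (-(2 * (N - a + 1)))) =
      ((t : ℝ) ^ (2 : ℤ) - (t : ℝ) ^ (-2 : ℤ)) *
        ((t : ℝ) ^ (2 * (N - 2 * a)) - (t : ℝ) ^ (-(2 * (N - 2 * a)))) := by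
    simp only [mul_sub, sub_mul, ← zpow_add₀ ht]
    ring_nf
  simp only [qnum]
  generalize (t : ℝ) ^ (2 : ℤ) - (t : ℝ) ^ (-2 : ℤ) = d at key ⊢
  by_cases hd : d = 0
  · simp [hd]
  · rw [div_mul_div_comm, div_mul_div_comm, ← sub_div, key]
    field_simp

/-- The irreducible representation `(V^j, π^j)`, with `N = 2j`. -/
def irrep (t : ℝˣ) (N : ℕ) : U t →ₐ[ℂ] Module.End ℂ (V N) :=
  (Matrix.toLinAlgEquiv' : Matrix (Fin (N + 1)) (Fin (N + 1)) ℂ ≃ₐ[ℂ] _).toAlgHom.comp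
    (lift (t := t) (eMat t N) (fMat t N) (kMat t N 1) (kMat t N (-1))
      (by
        simp only [kMat, Matrix.diagonal_mul_diagonal, ← zpow_add₀ (t_ne t)]
        simp)
      (by
        simp only [kMat, Matrix.diagonal_mul_diagonal, ← zpow_add₀ (t_ne t)]
        simp)
      (by
        ext a b
        simp only [kMat, Matrix.diagonal_mul, Matrix.mul_diagonal, Matrix.smul_apply, smul_eq_mul,
          eMat, Matrix.of_apply]
        split_ifs with h
        · rw [mul_comm, mul_left_comm, ← zpow_add₀ (t_ne t), ← h]
          congr 2
          push_cast
          ring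
        · simp)
      (by
        ext a b
        simp only [kMat, Matrix.diagonal_mul, Matrix.mul_diagonal, Matrix.smul_apply, smul_eq_mul,
          fMat, Matrix.of_apply]
        split_ifs with h
        · rw [mul_comm, mul_left_comm, ← zpow_add₀ (t_ne t), h]
          congr 2
          push_cast
          ring
        · simp)
      (by
        ext a b
        rw [Matrix.sub_apply, eMat_mul_fMat_apply, fMat_mul_eMat_apply]
        simp only [kMat, pow_two, Matrix.diagonal_mul_diagonal, Matrix.smul_apply,
          Matrix.sub_apply, Matrix.diagonal_apply, ← zpow_add₀ (t_ne t), smul_eq_mul]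
        split_ifs with h
        · rw [← Complex.ofReal_sub, qnum_identity]
          push_cast
          ring_nf
        · simp))

/-- The matrix element `π^j(a)_{mn}` in the weight basis: `π^j(a) e_n = ∑ₘ π^j(a)_{mn} e_m`. -/
def matEl (t : ℝˣ) (N : ℕ) (a : U t) (m n : Fin (N + 1)) : ℂ := irrep t N a (wt N n) m

/-! ### The elements `λ^l_m` -/

/-- The elements `λ^l_m = ([l+m]! / ([2l]! [l-m]!))^{1/2} (ad f)^{l-m} (e^l k^{-l})` of
`U_t(su(2))`, with `s = l - m`. -/
def lam (t : ℝˣ) (l : ℕ) (s : Fin (2 * l + 1)) : U t :=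
  ((Real.sqrt (qfact t (2 * l - s) / (qfact t (2 * l) * qfact t s)) : ℝ) : ℂ) •
    ((HopfRep.ad (U t) (f t)) ^ (s : ℕ)) (e t ^ l * kinv t ^ l)

/-- The subspace `U^l` of `U_t(su(2))`. -/
def Ul (t : ℝˣ) (l : ℕ) : Submodule ℂ (U t) := Submodule.span ℂ (Set.range (lam t l))

/-! ### Clebsch-Gordan coefficients -/

/-- `C p n m` are the Clebsch-Gordan coefficients `(κ p, ℓ n | j m)_t` of the component `V^j` of
`V^κ ⊗ V^ℓ`, where `K = 2κ`, `L = 2ℓ`, `J = 2j` and weights are indexed as in `V N`.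

In the Clebsch-Gordan decomposition `e_p ⊗ e_n = ∑ⱼ ∑ₘ (κ p, ℓ n | j m)_t e^j_m` the `V^j`-part is
the projection `T : V^κ ⊗ V^ℓ → V^j`, `T (e_p ⊗ e_n) = ∑ₘ (κ p, ℓ n | j m)_t e_m`, which is a
homomorphism of representations; the coupled vectors
`e^j_m = ∑_{p,n} (κ p, ℓ n | j m)_t e_p ⊗ e_n` are orthonormal (for the scalar product in which the
`e_p ⊗ e_n` are orthonormal). These two conditions determine the coefficients, which are real, up
to a common sign. For `t > 0` the sign is the usual one, `(κ κ, ℓ (j-κ) | j j)_t > 0`; in general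
`(κ κ, ℓ (j-κ) | j j)_t` has the sign of `t^{-(κ+ℓ-j)(j+ℓ-κ+1)}`, as in the closed formulae for
the coefficients. -/
structure IsClebschGordan (t : ℝˣ) (K L J : ℕ)
    (C : Fin (K + 1) → Fin (L + 1) → Fin (J + 1) → ℝ) : Prop where
  exists_hom : ∃ T : V K ⊗[ℂ] V L →ₗ[ℂ] V J,
    (∀ p n, T (wt K p ⊗ₜ[ℂ] wt L n) = ∑ m, (C p n m : ℂ) • wt J m) ∧
    ∀ a : U t, T ∘ₗ HopfRep.tensorRep (irrep t K) (irrep t L) a = irrep t J a ∘ₗ T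
  orthonormal : ∀ m m', ∑ p, ∑ n, C p n m * C p n m' = if m = m' then 1 else 0
  phase : ∀ n : Fin (L + 1), K + L = J + 2 * n → 0 < (t : ℝ) ^ ((n : ℕ) * (L + 1 - n)) * C 0 n 0

open Classical in
/-- The Clebsch-Gordan coefficients `(κ p, ℓ n | j m)_t`, with `K = 2κ`, `L = 2ℓ`, `J = 2j`; they
are zero when `V^j` does not occur in `V^κ ⊗ V^ℓ`. -/
def cg (t : ℝˣ) (K L J : ℕ) : Fin (K + 1) → Fin (L + 1) → Fin (J + 1) → ℝ :=
  if h : ∃ C, IsClebschGordan t K L J C then h.choose else 0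

/-- `α = t^{l(l+1)} [l]! ([2j+l+1]! / ([2l]! [2j-l]! [2j+1]))^{1/2}`, with `N = 2j` and `l ≤ 2j`. -/
def reducedMatrixElement (t : ℝˣ) (l N : ℕ) : ℝ :=
  (t : ℝ) ^ (l * (l + 1)) * qfact t l *
    Real.sqrt (qfact t (N + l + 1) / (qfact t (2 * l) * qfact t (N - l) * qnum t (N + 1)))

end QuantumSU2

end

open scoped TensorProduct

noncomputable section

namespace QuantumSU2

/-! ### `q`-numbers -/

/-! This is a Wigner–Eckart argument. Write `N` for `2j`. The element `e^l k^{-l}` is a highest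
weight vector of weight `l` for the adjoint representation: `ad_e` kills it (`ad_e_highest`), and so
does the power `2l+1` of `ad_f`, because the Leibniz rule makes orders of nilpotency additive
(`ad_f_pow_mul_eq_zero`). Hence `e_p ↦ λ^l_p` is an intertwiner from `V^l` onto `U^l`
(`lamMap_intertwines`). It is nonzero, so irreducibility of `V^l` gives both linear independence and
irreducibility of `U^l`.

Since `∑ ad_{a₍₁₎}(u) a₍₂₎ = a u`, the action `λ ⊗ v ↦ π^j(λ) v` is an intertwiner `V^l ⊗ V^j → V^j`
(`lamAct_intertwines`). Such a map is determined by one number, the top coordinate of the image of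
`e_l ⊗ e_{j-l}` (`coupling_eq_zero`). For `l > 2j` there is no vector `e_{j-l}`, so the action is
zero and no Clebsch–Gordan family exists.

For `l ≤ 2j` it remains to normalize. The matrices of `e` and `f` are transposes of each other, and
the coproduct respects this. So for the matrix `M` of an intertwiner, `M Mᵀ` commutes with `V^j` and
is scalar by Schur's lemma (`coupling_orthogonal`). The scalar is the sum of squares in the top row;
a two-term recursion expresses these squares by products of `q`-multiset coefficients, and the
`q`-Vandermonde identity sums them to `α²` (`sum_coupling_sq`, `reducedMatrixElement_sq`). Division
by `α > 0` gives real coefficients with the prescribed phase, which are unique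
(`IsClebschGordan.unique`). -/

lemma sq_sub_ne_zero {t : ℝˣ} (ht : t ≠ 1) (ht' : t ≠ -1) :
    (t : ℝ) ^ (2 : ℤ) - (t : ℝ) ^ (-2 : ℤ) ≠ 0 := by
  have h0 : (t : ℝ) ≠ 0 := t.ne_zero
  intro h
  have h1 : ((t : ℝ) ^ 2) ^ 2 = 1 := by
    rw [zpow_neg, sub_eq_zero] at h
    have h2 : (t : ℝ) ^ (2 : ℤ) ≠ 0 := zpow_ne_zero _ h0
    rw [pow_two]
    exact (congrArg (· * (t : ℝ) ^ (2 : ℤ)) h).trans (inv_mul_cancel₀ h2)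
  have h2 : (t : ℝ) ^ 2 = 1 := (pow_eq_one_iff_of_nonneg (by positivity) two_ne_zero).1 h1
  rcases eq_or_eq_neg_of_sq_eq_sq (t : ℝ) 1 (h2.trans (one_pow 2).symm) with h | h
  · exact ht (Units.ext h)
  · exact ht' (Units.ext h)

/-- As `t` is real, `t ≠ ±1` means `|t| ≠ 1`; distinct weights therefore give distinct eigenvalues
of `k`. -/
lemma zpow_injective {t : ℝˣ} (ht : t ≠ 1) (ht' : t ≠ -1) :
    Function.Injective fun n : ℤ => ((t : ℝ) : ℂ) ^ n := by
  intro a b h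
  have h0 : 0 < |(t : ℝ)| := abs_pos.2 t.ne_zero
  refine zpow_right_injective₀ h0 ?_ (?_ : |(t : ℝ)| ^ a = |(t : ℝ)| ^ b)
  · intro h
    rcases eq_or_eq_neg_of_abs_eq h with h | h
    · exact ht (Units.ext h)
    · exact ht' (Units.ext h)
  · have : (t : ℝ) ^ a = (t : ℝ) ^ b := by
      simp only [← Complex.ofReal_zpow] at h
      exact Complex.ofReal_injective h
    rw [← abs_zpow, ← abs_zpow, this]

@[simp] lemma qnum_zero (t : ℝˣ) : qnum t 0 = 0 := by simp [qnum]

lemma qnum_add (t : ℝˣ) (a b : ℤ) :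
    qnum t (a + b) = (t : ℝ) ^ (-(2 * b)) * qnum t a + (t : ℝ) ^ (2 * a) * qnum t b := by
  have h0 : (t : ℝ) ≠ 0 := t.ne_zero
  simp only [qnum, mul_div_assoc', ← add_div, mul_sub, ← zpow_add₀ h0]
  congr 1
  ring_nf

lemma qnum_pos {t : ℝˣ} (ht : t ≠ 1) (ht' : t ≠ -1) {n : ℤ} (hn : 0 < n) : 0 < qnum t n := by
  have h0 : (t : ℝ) ≠ 0 := t.ne_zero
  lift n to ℕ using hn.le
  refine lt_of_le_of_ne (qnum_nonneg t n) (Ne.symm ?_)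
  rw [qnum]
  refine div_ne_zero ?_ (sq_sub_ne_zero ht ht')
  rw [sub_ne_zero]
  intro h
  have := zpow_injective ht ht' (a₁ := 2 * (n : ℤ)) (a₂ := -(2 * (n : ℤ)))
    (by simp only [← Complex.ofReal_zpow, h])
  omega

lemma qnum_ne_zero {t : ℝˣ} (ht : t ≠ 1) (ht' : t ≠ -1) {n : ℤ} (hn : 0 < n) : qnum t n ≠ 0 :=
  (qnum_pos ht ht' hn).ne'

@[simp] lemma qfact_zero (t : ℝˣ) : qfact t 0 = 1 := by simp [qfact]

lemma qfact_succ (t : ℝˣ) (n : ℕ) : qfact t (n + 1) = qfact t n * qnum t (n + 1) := by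
  simp [qfact, Finset.prod_range_succ]

lemma qfact_pos {t : ℝˣ} (ht : t ≠ 1) (ht' : t ≠ -1) (n : ℕ) : 0 < qfact t n :=
  Finset.prod_pos fun i _ => qnum_pos ht ht' (by omega)

/-- The `q`-multiset coefficient `[a][a+1]⋯[a+p-1] / [p]!`. -/
def qmulti (t : ℝˣ) (a p : ℕ) : ℝ := (∏ i ∈ Finset.range p, qnum t (a + i)) / qfact t p

@[simp] lemma qmulti_zero_right (t : ℝˣ) (a : ℕ) : qmulti t a 0 = 1 := by simp [qmulti]

lemma qmulti_zero_left (t : ℝˣ) (p : ℕ) : qmulti t 0 (p + 1) = 0 := by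
  simp [qmulti, Finset.prod_range_succ']

lemma qmulti_succ_right {t : ℝˣ} (ht : t ≠ 1) (ht' : t ≠ -1) (a p : ℕ) :
    qmulti t a (p + 1) * qnum t (p + 1) = qmulti t a p * qnum t (a + p) := by
  have h1 := (qfact_pos ht ht' p).ne'
  have h2 := qnum_ne_zero ht ht' (n := p + 1) (by omega)
  rw [qmulti, qmulti, Finset.prod_range_succ, qfact_succ]
  field_simp

lemma qfact_mul_prod (t : ℝˣ) (a p : ℕ) :
    qfact t a * ∏ i ∈ Finset.range p, qnum t ((a + 1 : ℕ) + i) = qfact t (a + p) := by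
  rw [qfact, qfact, Finset.prod_range_add]
  congr 1
  refine Finset.prod_congr rfl fun i _ => ?_
  congr 1
  push_cast
  ring

lemma qmulti_eq {t : ℝˣ} (ht : t ≠ 1) (ht' : t ≠ -1) (a p : ℕ) :
    qmulti t (a + 1) p = qfact t (a + p) / (qfact t a * qfact t p) := by
  have h1 := (qfact_pos ht ht' a).ne'
  rw [qmulti, ← qfact_mul_prod t a p, mul_div_mul_left _ _ h1]

/-- Both sides are `[a][a+1]⋯[a+p] / [p]!`, with the first or the last factor split off. -/
lemma qmulti_succ_left_mul {t : ℝˣ} (a p : ℕ) :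
    qmulti t (a + 1) p * qnum t a = qmulti t a p * qnum t (a + p) := by
  rw [qmulti, qmulti, div_mul_eq_mul_div, div_mul_eq_mul_div]
  congr 1
  have h1 := Finset.prod_range_succ (fun i : ℕ => qnum t (a + i)) p
  have h2 := Finset.prod_range_succ' (fun i : ℕ => qnum t (a + i)) p
  rw [h1] at h2
  rw [h2, Nat.cast_zero, add_zero]
  congr 1
  refine Finset.prod_congr rfl fun i _ => ?_
  congr 1
  push_cast
  ring

/-- Pascal's rule. -/
lemma qmulti_succ_succ {t : ℝˣ} (ht : t ≠ 1) (ht' : t ≠ -1) (a p : ℕ) :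
    qmulti t (a + 1) (p + 1) = (t : ℝ) ^ (-(2 * (p + 1 : ℤ))) * qmulti t a (p + 1) +
      (t : ℝ) ^ (2 * (a : ℤ)) * qmulti t (a + 1) p := by
  have h2 := qnum_ne_zero ht ht' (n := p + 1) (by omega)
  have e1 := qmulti_succ_right ht ht' (a + 1) p
  have e2 := qmulti_succ_right ht ht' a p
  have e3 := qmulti_succ_left_mul (t := t) a p
  have e4 := qnum_add t a (p + 1)
  push_cast at e1
  rw [show (a : ℤ) + 1 + p = a + (p + 1) by ring, e4] at e1
  refine mul_right_cancel₀ h2 ?_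
  rw [e1, add_mul, mul_assoc _ (qmulti t a (p + 1)), e2, ← e3]
  ring

/-- The `q`-Vandermonde identity. -/
lemma sum_antidiagonal_qmulti {t : ℝˣ} (ht : t ≠ 1) (ht' : t ≠ -1) (b s a : ℕ) :
    ∑ x ∈ Finset.HasAntidiagonal.antidiagonal s, (t : ℝ) ^ (2 * (a + b + 1) * x.1) *
      (qmulti t a x.1 * qmulti t (b + 1) x.2) =
      (t : ℝ) ^ (2 * s * a) * qmulti t (a + b + 1) s := by
  have h0 : (t : ℝ) ≠ 0 := t.ne_zero
  induction s generalizing a with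
  | zero => simp
  | succ s ihs =>
    induction a with
    | zero =>
      rw [Finset.Nat.sum_antidiagonal_succ]
      simp [qmulti_zero_left]
    | succ a iha =>
      rw [Finset.Nat.sum_antidiagonal_succ] at iha ⊢
      have e := qmulti_succ_succ ht ht' (a + b + 1) s
      -- Pascal's rule for the first factor, in the terms with positive first index, leaves the same
      -- sum for `a` and a multiple of the full sum of order `s` for `a + 1`; both are known by
      -- induction.
      have key : ∑ x ∈ Finset.HasAntidiagonal.antidiagonal s, (t : ℝ) ^ (2 * (a + 1 + b + 1) * (x.1 + 1)) *
          (qmulti t (a + 1) (x.1 + 1) * qmulti t (b + 1) x.2) =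
          ∑ x ∈ Finset.HasAntidiagonal.antidiagonal s, (t : ℝ) ^ (2 * (a + b + 1) * (x.1 + 1)) *
          (qmulti t a (x.1 + 1) * qmulti t (b + 1) x.2) +
          (t : ℝ) ^ (2 * (2 * a + b + 2)) * ∑ x ∈ Finset.HasAntidiagonal.antidiagonal s,
            (t : ℝ) ^ (2 * (a + 1 + b + 1) * x.1) *
            (qmulti t (a + 1) x.1 * qmulti t (b + 1) x.2) := by
        rw [Finset.mul_sum, ← Finset.sum_add_distrib]
        refine Finset.sum_congr rfl fun x _ => ?_
        rw [qmulti_succ_succ ht ht']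
        have e1 : (t : ℝ) ^ (2 * (a + 1 + b + 1) * (x.1 + 1)) * (t : ℝ) ^ (-(2 * (x.1 + 1 : ℤ))) =
            (t : ℝ) ^ (2 * (a + b + 1) * (x.1 + 1)) := by
          rw [← zpow_natCast, ← zpow_natCast, ← zpow_add₀ h0]
          congr 1
          push_cast
          ring
        have e2 : (t : ℝ) ^ (2 * (a + 1 + b + 1) * (x.1 + 1)) * (t : ℝ) ^ (2 * (a : ℤ)) =
            (t : ℝ) ^ (2 * (2 * a + b + 2)) * (t : ℝ) ^ (2 * (a + 1 + b + 1) * x.1) := by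
          simp only [← zpow_natCast, ← zpow_add₀ h0]
          congr 1
          push_cast
          ring
        linear_combination (qmulti t a (x.1 + 1) * qmulti t (b + 1) x.2) * e1 +
          (qmulti t (a + 1) x.1 * qmulti t (b + 1) x.2) * e2
      rw [key, ihs]
      simp only [mul_zero, pow_zero, one_mul, qmulti_zero_right] at iha ⊢
      rw [← add_assoc, iha, show a + 1 + b + 1 = a + b + 1 + 1 by ring, e]
      have e1 : (t : ℝ) ^ (2 * (s + 1) * (a + 1)) * (t : ℝ) ^ (-(2 * (s + 1 : ℤ))) =
          (t : ℝ) ^ (2 * (s + 1) * a) := by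
        rw [← zpow_natCast, ← zpow_natCast, ← zpow_add₀ h0]
        congr 1
        push_cast
        ring
      have e2 : (t : ℝ) ^ (2 * (s + 1) * (a + 1)) * (t : ℝ) ^ (2 * ((a + b + 1 : ℕ) : ℤ)) =
          (t : ℝ) ^ (2 * (2 * a + b + 2)) * (t : ℝ) ^ (2 * s * (a + 1)) := by
        simp only [← zpow_natCast, ← zpow_add₀ h0]
        congr 1
        push_cast
        ring
      linear_combination -qmulti t (a + b + 1) (s + 1) * e1 - qmulti t (a + b + 1 + 1) s * e2

/-! ### Intertwiners and invariant subspaces -/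

section Generators

variable {t : ℝˣ} {X Y : Type*} [AddCommGroup X] [Module ℂ X] [AddCommGroup Y] [Module ℂ Y]

lemma intertwines_of_generators {ρ : U t →ₐ[ℂ] Module.End ℂ X} {σ : U t →ₐ[ℂ] Module.End ℂ Y}
    {T : X →ₗ[ℂ] Y} (he : T ∘ₗ ρ (e t) = σ (e t) ∘ₗ T) (hf : T ∘ₗ ρ (f t) = σ (f t) ∘ₗ T)
    (hk : T ∘ₗ ρ (k t) = σ (k t) ∘ₗ T) (hk' : T ∘ₗ ρ (kinv t) = σ (kinv t) ∘ₗ T) (a : U t) :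
    T ∘ₗ ρ a = σ a ∘ₗ T := by
  induction a using U_induction with
  | hc c => ext x; simp [Algebra.algebraMap_eq_smul_one]
  | he => exact he
  | hf => exact hf
  | hk => exact hk
  | hk' => exact hk'
  | hadd a b ha hb => rw [map_add, map_add, LinearMap.comp_add, LinearMap.add_comp, ha, hb]
  | hmul a b ha hb =>
    rw [map_mul, map_mul, Module.End.mul_eq_comp, Module.End.mul_eq_comp, ← LinearMap.comp_assoc,
      ha, LinearMap.comp_assoc, hb, LinearMap.comp_assoc]

/-- The image of an irreducible representation under a nonzero intertwiner is irreducible. -/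
lemma isIrreducibleOn_range {ρ : U t →ₐ[ℂ] Module.End ℂ X} {σ : U t →ₐ[ℂ] Module.End ℂ Y}
    {T : X →ₗ[ℂ] Y} (hT : ∀ a, T ∘ₗ ρ a = σ a ∘ₗ T) (hρ : HopfRep.IsIrreducibleOn ρ ⊤)
    (h0 : T ≠ 0) : HopfRep.IsIrreducibleOn σ (LinearMap.range T) where
  ne_bot := by rwa [Ne, LinearMap.range_eq_bot]
  invariant := by
    rintro a _ ⟨x, rfl⟩
    exact ⟨ρ a x, LinearMap.congr_fun (hT a) x⟩
  eq_bot_or_eq := by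
    intro S' hS' hinv
    have key := hρ.eq_bot_or_eq (S'.comap T) le_top fun a x hx => by
      have h : T (ρ a x) = σ a (T x) := LinearMap.congr_fun (hT a) x
      rw [Submodule.mem_comap, h]
      exact hinv a _ hx
    rcases key with h | h
    · left
      rw [← Submodule.map_comap_eq_of_le hS', h, Submodule.map_bot]
    · right
      refine le_antisymm hS' ?_
      rintro _ ⟨x, rfl⟩
      have : x ∈ S'.comap T := h ▸ Submodule.mem_top
      exact this

/-- A nonzero intertwiner from an irreducible representation is injective. -/
lemma ker_eq_bot_of_irreducible {ρ : U t →ₐ[ℂ] Module.End ℂ X} {σ : U t →ₐ[ℂ] Module.End ℂ Y}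
    {T : X →ₗ[ℂ] Y} (hT : ∀ a, T ∘ₗ ρ a = σ a ∘ₗ T) (hρ : HopfRep.IsIrreducibleOn ρ ⊤)
    (h0 : T ≠ 0) : LinearMap.ker T = ⊥ := by
  refine (hρ.eq_bot_or_eq (LinearMap.ker T) le_top fun a x hx => ?_).resolve_right fun h =>
    h0 (LinearMap.ker_eq_top.1 h)
  have h : T (ρ a x) = σ a (T x) := LinearMap.congr_fun (hT a) x
  rw [LinearMap.mem_ker] at hx ⊢
  rw [h, hx, map_zero]

end Generators

/-! ### Weight vectors of `V^j` -/

/-- The weight vector with index `s`, which is zero for `s > N`. -/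
def wv (N s : ℕ) : V N := fun i => if (i : ℕ) = s then 1 else 0

lemma wt_eq_wv (N : ℕ) (s : Fin (N + 1)) : wt N s = wv N s := by
  ext i
  simp [wt, wv, Pi.single_apply, Fin.ext_iff]

lemma wv_of_lt {N s : ℕ} (h : N < s) : wv N s = 0 := by
  ext i
  have : (i : ℕ) ≠ s := by omega
  simp [wv, this]

lemma wv_zero_apply_zero (N : ℕ) : wv N 0 0 = 1 := by simp [wv]

lemma linearMap_ext_wv {N : ℕ} {X : Type*} [AddCommGroup X] [Module ℂ X] {T T' : V N →ₗ[ℂ] X}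
    (h : ∀ s ≤ N, T (wv N s) = T' (wv N s)) : T = T' := by
  refine (Pi.basisFun ℂ (Fin (N + 1))).ext fun s => ?_
  have hs : Pi.basisFun ℂ (Fin (N + 1)) s = wv N s := by
    rw [← wt_eq_wv, wt, Pi.basisFun_apply]
  rw [hs]
  exact h s (by omega)

lemma irrep_e_apply (t : ℝˣ) (N : ℕ) (x : V N) : irrep t N (e t) x = (eMat t N).mulVec x := by
  simp [irrep]

lemma irrep_f_apply (t : ℝˣ) (N : ℕ) (x : V N) : irrep t N (f t) x = (fMat t N).mulVec x := by
  simp [irrep]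

lemma irrep_k_apply (t : ℝˣ) (N : ℕ) (x : V N) : irrep t N (k t) x = (kMat t N 1).mulVec x := by
  simp [irrep]

lemma irrep_kinv_apply (t : ℝˣ) (N : ℕ) (x : V N) :
    irrep t N (kinv t) x = (kMat t N (-1)).mulVec x := by
  simp [irrep]

lemma mulVec_wv {N s : ℕ} (M : Matrix (Fin (N + 1)) (Fin (N + 1)) ℂ) (hs : s ≤ N) :
    M.mulVec (wv N s) = fun i => M i ⟨s, by omega⟩ := by
  have : wv N s = Pi.single (⟨s, by omega⟩ : Fin (N + 1)) 1 := (wt_eq_wv N ⟨s, by omega⟩).symm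
  rw [this]
  ext i
  simp

/-- The square root of `[N - b][b + 1]`. -/
def ladder (t : ℝˣ) (N b : ℕ) : ℝ := Real.sqrt (qnum t (N - b) * qnum t (b + 1))

lemma ladder_self (t : ℝˣ) (N : ℕ) : ladder t N N = 0 := by simp [ladder]

lemma ladder_sq {t : ℝˣ} {N b : ℕ} (h : b ≤ N) :
    ladder t N b ^ 2 = qnum t (N - b) * qnum t (b + 1) := by
  have h1 := qnum_nonneg t (N - b : ℕ)
  have h2 := qnum_nonneg t (b + 1)
  rw [Nat.cast_sub h] at h1
  push_cast at h2
  exact Real.sq_sqrt (mul_nonneg h1 h2)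

lemma ladder_pos {t : ℝˣ} (ht : t ≠ 1) (ht' : t ≠ -1) {N b : ℕ} (h : b < N) : 0 < ladder t N b :=
  Real.sqrt_pos.2 (mul_pos (qnum_pos ht ht' (by omega)) (qnum_pos ht ht' (by omega)))

/-- Indexed by its target, the coefficient of `e` is the coefficient of `f` indexed by its source.
One sequence of square roots thus serves both matrices, which are transposes of each other. -/
lemma eMat_apply (t : ℝˣ) (N : ℕ) (a b : Fin (N + 1)) :
    eMat t N a b = if (a : ℕ) + 1 = b then ((ladder t N a : ℝ) : ℂ) else 0 := by
  simp only [eMat, Matrix.of_apply, ladder]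
  split_ifs with h
  · rw [← h, mul_comm]
    push_cast
    ring_nf
  · rfl

lemma fMat_apply (t : ℝˣ) (N : ℕ) (a b : Fin (N + 1)) :
    fMat t N a b = if (a : ℕ) = b + 1 then ((ladder t N b : ℝ) : ℂ) else 0 := rfl

lemma irrep_e_wv_zero (t : ℝˣ) (N : ℕ) : irrep t N (e t) (wv N 0) = 0 := by
  rw [irrep_e_apply, mulVec_wv _ (Nat.zero_le _)]
  ext i
  simp [eMat_apply]

lemma irrep_e_wv_succ (t : ℝˣ) {N s : ℕ} (hs : s ≤ N) :
    irrep t N (e t) (wv N (s + 1)) = ((ladder t N s : ℝ) : ℂ) • wv N s := by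
  rcases hs.lt_or_eq with h | rfl
  · rw [irrep_e_apply, mulVec_wv _ (by omega)]
    ext i
    simp only [eMat_apply, wv, Pi.smul_apply, smul_eq_mul, add_left_inj]
    split_ifs with h
    · rw [h, mul_one]
    · rw [mul_zero]
  -- At `s = N` both sides vanish, since there is no vector of index `N + 1` and `ladder t N N = 0`.
  · rw [wv_of_lt (by omega), map_zero, ladder_self]
    simp

lemma irrep_f_wv (t : ℝˣ) {N s : ℕ} (hs : s ≤ N) :
    irrep t N (f t) (wv N s) = ((ladder t N s : ℝ) : ℂ) • wv N (s + 1) := by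
  rw [irrep_f_apply, mulVec_wv _ hs]
  ext i
  simp only [fMat_apply, wv, Pi.smul_apply, smul_eq_mul]
  split_ifs <;> simp

lemma irrep_k_wv (t : ℝˣ) (N s : ℕ) :
    irrep t N (k t) (wv N s) = ((t : ℝ) : ℂ) ^ ((N : ℤ) - 2 * s) • wv N s := by
  rw [irrep_k_apply, kMat]
  ext i
  simp only [Matrix.mulVec_diagonal, wv, Pi.smul_apply, smul_eq_mul]
  split_ifs with h
  · rw [h, one_mul]
  · simp

lemma irrep_kinv_wv (t : ℝˣ) (N s : ℕ) :
    irrep t N (kinv t) (wv N s) = ((t : ℝ) : ℂ) ^ (-((N : ℤ) - 2 * s)) • wv N s := by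
  rw [irrep_kinv_apply, kMat]
  ext i
  simp only [Matrix.mulVec_diagonal, wv, Pi.smul_apply, smul_eq_mul]
  split_ifs with h
  · rw [h, neg_one_mul]
  · simp

lemma irrep_e_apply_apply (t : ℝˣ) {N : ℕ} (x : V N) {i j : Fin (N + 1)} (h : (i : ℕ) + 1 = j) :
    irrep t N (e t) x i = ((ladder t N i : ℝ) : ℂ) * x j := by
  rw [irrep_e_apply, Matrix.mulVec, dotProduct, Finset.sum_eq_single j]
  · rw [eMat_apply, if_pos h]
  · intro b _ hb
    rw [eMat_apply, if_neg (fun h' => hb (Fin.ext (by omega))), zero_mul]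
  · simp

lemma irrep_f_apply_zero (t : ℝˣ) {N : ℕ} (x : V N) : irrep t N (f t) x 0 = 0 := by
  rw [irrep_f_apply, Matrix.mulVec, dotProduct, Finset.sum_eq_zero]
  intro b _
  rw [fMat_apply, if_neg (by simp), zero_mul]

lemma irrep_k_apply_apply (t : ℝˣ) {N : ℕ} (x : V N) (i : Fin (N + 1)) :
    irrep t N (k t) x i = ((t : ℝ) : ℂ) ^ ((N : ℤ) - 2 * i) * x i := by
  rw [irrep_k_apply, kMat, Matrix.mulVec_diagonal, one_mul]

/-- A subspace of `V^j` that is stable under `f` and contains the highest weight vector is the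
whole space. -/
lemma eq_top_of_wv_zero_mem {t : ℝˣ} (ht : t ≠ 1) (ht' : t ≠ -1) {N : ℕ} {S : Submodule ℂ (V N)}
    (hf : ∀ x ∈ S, irrep t N (f t) x ∈ S) (h0 : wv N 0 ∈ S) : S = ⊤ := by
  have hS : ∀ s, wv N s ∈ S := by
    intro s
    induction s with
    | zero => exact h0
    | succ s ih =>
      by_cases hs : s < N
      · have h := hf _ ih
        rw [irrep_f_wv t hs.le] at h
        exact (S.smul_mem_iff (by exact_mod_cast (ladder_pos ht ht' hs).ne')).1 h
      · rw [wv_of_lt (by omega)]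
        exact S.zero_mem
  rw [eq_top_iff]
  intro x _
  rw [pi_eq_sum_univ x]
  refine S.sum_mem fun i _ => S.smul_mem _ ?_
  convert hS i using 1
  ext j
  simp [wv, Fin.ext_iff, eq_comm]

/-- Applying `e` repeatedly to a vector extracts its component of lowest weight. -/
lemma wv_zero_mem_of_apply_ne_zero {t : ℝˣ} (ht : t ≠ 1) (ht' : t ≠ -1) {N : ℕ}
    {S : Submodule ℂ (V N)} (he : ∀ x ∈ S, irrep t N (e t) x ∈ S) (s : ℕ) {x : V N} (hx : x ∈ S)
    (h0 : x ≠ 0) (hs : ∀ i : Fin (N + 1), s < (i : ℕ) → x i = 0) : wv N 0 ∈ S := by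
  induction s generalizing x with
  | zero =>
    have hx0 : x = x 0 • wv N 0 := by
      ext i
      by_cases hi : i = 0
      · subst hi
        simp [wv_zero_apply_zero]
      · have : (i : ℕ) ≠ 0 := fun h => hi (Fin.ext h)
        rw [hs i (by omega)]
        simp [wv, this]
    have h1 : x 0 ≠ 0 := fun h => h0 (by rw [hx0, h, zero_smul])
    rw [hx0] at hx
    exact (S.smul_mem_iff h1).1 hx
  | succ s ih =>
    by_cases hxs : ∀ i : Fin (N + 1), s < (i : ℕ) → x i = 0
    · exact ih hx h0 hxs
    push Not at hxs
    obtain ⟨j, hj, hxj⟩ := hxs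
    have hj' : (j : ℕ) = s + 1 := by
      by_contra h
      exact hxj (hs j (by omega))
    -- `e` lowers indices by one: the last nonzero coordinate, at `s + 1`, moves to `s` with a
    -- nonzero factor, and nothing remains beyond `s`.
    refine ih (he x hx) ?_ ?_
    · intro h
      have h1 := congrFun h (⟨s, by omega⟩ : Fin (N + 1))
      rw [irrep_e_apply_apply t x (j := j) (by simp [hj'])] at h1
      have h2 := (ladder_pos ht ht' (N := N) (b := s) (by omega)).ne'
      simp only [Pi.zero_apply, mul_eq_zero, Complex.ofReal_eq_zero] at h1
      exact h1.elim h2 hxj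
    · intro i hi
      by_cases hiN : (i : ℕ) < N
      · rw [irrep_e_apply_apply t x (j := ⟨i + 1, by omega⟩) rfl, hs _ (by simp; omega), mul_zero]
      · rw [irrep_e_apply, Matrix.mulVec, dotProduct, Finset.sum_eq_zero]
        intro b _
        rw [eMat_apply, if_neg (by omega), zero_mul]

lemma eq_bot_or_eq_top_of_stable {t : ℝˣ} (ht : t ≠ 1) (ht' : t ≠ -1) {N : ℕ}
    {S : Submodule ℂ (V N)} (he : ∀ x ∈ S, irrep t N (e t) x ∈ S)
    (hf : ∀ x ∈ S, irrep t N (f t) x ∈ S) : S = ⊥ ∨ S = ⊤ := by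
  by_cases h : S = ⊥
  · exact Or.inl h
  obtain ⟨x, hx, h0⟩ := S.ne_bot_iff.1 h
  exact Or.inr (eq_top_of_wv_zero_mem ht ht' hf
    (wv_zero_mem_of_apply_ne_zero ht ht' he N hx h0 fun i hi => by omega))

lemma isIrreducibleOn_irrep {t : ℝˣ} (ht : t ≠ 1) (ht' : t ≠ -1) (N : ℕ) :
    HopfRep.IsIrreducibleOn (irrep t N) ⊤ where
  ne_bot := top_ne_bot
  invariant _ _ _ := Submodule.mem_top
  eq_bot_or_eq _ _ h := eq_bot_or_eq_top_of_stable ht ht' (h _) (h _)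

/-- Schur's lemma for `V^j`. -/
lemma exists_eq_smul_of_commute {t : ℝˣ} (ht : t ≠ 1) (ht' : t ≠ -1) {N : ℕ}
    {G : Module.End ℂ (V N)} (he : G * irrep t N (e t) = irrep t N (e t) * G)
    (hf : G * irrep t N (f t) = irrep t N (f t) * G) : ∃ c : ℂ, ∀ x, G x = c • x := by
  -- Over `ℂ` there is an eigenvalue; its eigenspace is nonzero and stable under `e` and `f`, hence
  -- everything.
  obtain ⟨c, hc⟩ := Module.End.exists_eigenvalue G
  refine ⟨c, fun x => ?_⟩
  have hstable : ∀ A : Module.End ℂ (V N), G * A = A * G →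
      ∀ x ∈ G.eigenspace c, A x ∈ G.eigenspace c := by
    intro A hA x hx
    rw [Module.End.mem_eigenspace_iff] at hx ⊢
    rw [← Module.End.mul_apply, hA, Module.End.mul_apply, hx, map_smul]
  have h := (eq_bot_or_eq_top_of_stable ht ht' (hstable _ he) (hstable _ hf)).resolve_left hc
  exact Module.End.mem_eigenspace_iff.1 (h ▸ Submodule.mem_top)

/-! ### The adjoint representation -/

section Adjoint

variable {t : ℝˣ}

lemma ad_e_apply (x : U t) : HopfRep.ad (U t) (e t) x =
    e t * x * k t - ((t : ℝ) : ℂ) ^ (-2 : ℤ) • (k t * x * e t) := by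
  have h : HopfAlgebra.antipode ℂ (A := U t) = antipode t := rfl
  simp [HopfRep.ad, comul_eq, Δ, h, antipode_e, antipode_kinv, mul_assoc, sub_eq_add_neg]

lemma ad_f_apply (x : U t) : HopfRep.ad (U t) (f t) x =
    f t * x * k t - ((t : ℝ) : ℂ) ^ (2 : ℤ) • (k t * x * f t) := by
  have h : HopfAlgebra.antipode ℂ (A := U t) = antipode t := rfl
  simp [HopfRep.ad, comul_eq, Δ, h, antipode_f, antipode_kinv, mul_assoc, sub_eq_add_neg]

lemma ad_k_apply (x : U t) : HopfRep.ad (U t) (k t) x = k t * x * kinv t := by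
  have h : HopfAlgebra.antipode ℂ (A := U t) = antipode t := rfl
  simp [HopfRep.ad, comul_eq, Δ, h, antipode_k, mul_assoc]

lemma ad_kinv_apply (x : U t) : HopfRep.ad (U t) (kinv t) x = kinv t * x * k t := by
  have h : HopfAlgebra.antipode ℂ (A := U t) = antipode t := rfl
  simp [HopfRep.ad, comul_eq, Δ, h, antipode_kinv, mul_assoc]

/-- The twisted Leibniz rule for `ad_f`. -/
lemma ad_f_mul (x y : U t) : HopfRep.ad (U t) (f t) (x * y) =
    HopfRep.ad (U t) (f t) x * HopfRep.ad (U t) (kinv t) y +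
      HopfRep.ad (U t) (k t) x * HopfRep.ad (U t) (f t) y := by
  have h1 (z : U t) : k t * (kinv t * z) = z := by rw [← mul_assoc, k_mul_kinv, one_mul]
  have h2 (z : U t) : kinv t * (k t * z) = z := by rw [← mul_assoc, kinv_mul_k, one_mul]
  have h3 (z : U t) : kinv t * (f t * z) = ((t : ℝ) : ℂ) ^ (2 : ℤ) • (f t * (kinv t * z)) := by
    rw [← mul_assoc, kinv_mul_f, smul_mul_assoc, mul_assoc]
  simp only [ad_f_apply, ad_k_apply, ad_kinv_apply, sub_mul, mul_sub, smul_mul_assoc,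
    mul_smul_comm, mul_assoc, h1, h2, h3]
  abel

lemma k_mul_f_pow (n : ℕ) :
    k t * f t ^ n = ((t : ℝ) : ℂ) ^ (-(2 * n : ℤ)) • (f t ^ n * k t) := by
  induction n with
  | zero => simp
  | succ n ih =>
    rw [pow_succ, ← mul_assoc, ih, smul_mul_assoc, mul_assoc, k_mul_f, mul_smul_comm, smul_smul,
      ← zpow_add₀ (t_ne t), mul_assoc]
    congr 2
    push_cast
    ring

lemma kinv_mul_f_pow (n : ℕ) :
    kinv t * f t ^ n = ((t : ℝ) : ℂ) ^ (2 * n : ℤ) • (f t ^ n * kinv t) := by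
  induction n with
  | zero => simp
  | succ n ih =>
    rw [pow_succ, ← mul_assoc, ih, smul_mul_assoc, mul_assoc, kinv_mul_f, mul_smul_comm, smul_smul,
      ← zpow_add₀ (t_ne t), mul_assoc]
    congr 2

lemma k_mul_e_pow (n : ℕ) :
    k t * e t ^ n = ((t : ℝ) : ℂ) ^ (2 * n : ℤ) • (e t ^ n * k t) := by
  induction n with
  | zero => simp
  | succ n ih =>
    rw [pow_succ, ← mul_assoc, ih, smul_mul_assoc, mul_assoc, k_mul_e, mul_smul_comm, smul_smul,
      ← zpow_add₀ (t_ne t), mul_assoc]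
    congr 2

lemma kinv_mul_e_pow (n : ℕ) :
    kinv t * e t ^ n = ((t : ℝ) : ℂ) ^ (-(2 * n : ℤ)) • (e t ^ n * kinv t) := by
  induction n with
  | zero => simp
  | succ n ih =>
    rw [pow_succ, ← mul_assoc, ih, smul_mul_assoc, mul_assoc, kinv_mul_e, mul_smul_comm, smul_smul,
      ← zpow_add₀ (t_ne t), mul_assoc]
    congr 2
    push_cast
    ring

lemma kinv_pow_mul_e (n : ℕ) :
    kinv t ^ n * e t = ((t : ℝ) : ℂ) ^ (-(2 * n : ℤ)) • (e t * kinv t ^ n) := by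
  induction n with
  | zero => simp
  | succ n ih =>
    rw [pow_succ, mul_assoc, kinv_mul_e, mul_smul_comm, ← mul_assoc, ih, smul_mul_assoc, smul_smul,
      ← zpow_add₀ (t_ne t), mul_assoc]
    congr 2
    push_cast
    ring

lemma commute_k_kinv : Commute (k t) (kinv t) := by
  rw [Commute, SemiconjBy, k_mul_kinv, kinv_mul_k]

/-- `k f^n` and `f^n k` differ by a nonzero scalar, so the twists by `k^{±1}` in the Leibniz rule
preserve the order of nilpotency of a factor. -/
lemma ad_f_pow_ad_k_eq_zero {n : ℕ} {x : U t} (h : HopfRep.ad (U t) (f t ^ n) x = 0) :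
    HopfRep.ad (U t) (f t ^ n) (HopfRep.ad (U t) (k t) x) = 0 := by
  have h1 := congrArg (fun a => HopfRep.ad (U t) a x) (k_mul_f_pow (t := t) n)
  simp only [map_mul, map_smul, Module.End.mul_apply, LinearMap.smul_apply, h, map_zero] at h1
  exact (smul_eq_zero.1 h1.symm).resolve_left (zpow_ne_zero _ (t_ne t))

lemma ad_f_pow_ad_kinv_eq_zero {n : ℕ} {x : U t} (h : HopfRep.ad (U t) (f t ^ n) x = 0) :
    HopfRep.ad (U t) (f t ^ n) (HopfRep.ad (U t) (kinv t) x) = 0 := by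
  have h1 := congrArg (fun a => HopfRep.ad (U t) a x) (kinv_mul_f_pow (t := t) n)
  simp only [map_mul, map_smul, Module.End.mul_apply, LinearMap.smul_apply, h, map_zero] at h1
  exact (smul_eq_zero.1 h1.symm).resolve_left (zpow_ne_zero _ (t_ne t))

/-- Local nilpotency of `ad_f` passes to products. -/
lemma ad_f_pow_mul_eq_zero (n : ℕ) {a b : ℕ} {x y : U t} (hab : a + b ≤ n + 1)
    (hx : HopfRep.ad (U t) (f t ^ a) x = 0) (hy : HopfRep.ad (U t) (f t ^ b) y = 0) :
    HopfRep.ad (U t) (f t ^ n) (x * y) = 0 := by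
  induction n generalizing a b x y with
  | zero =>
    rcases (by omega : a = 0 ∨ b = 0) with rfl | rfl
    · have : x = 0 := by simpa using hx
      simp [this]
    · have : y = 0 := by simpa using hy
      simp [this]
  | succ n ih =>
    rcases a with _ | a
    · have : x = 0 := by simpa using hx
      simp [this]
    rcases b with _ | b
    · have : y = 0 := by simpa using hy
      simp [this]
    have hx' := hx
    have hy' := hy
    -- In each summand of the Leibniz rule one of the two orders `a + 1`, `b + 1` drops by one and
    -- the other is kept.
    rw [pow_succ, map_mul, Module.End.mul_apply] at hx hy
    rw [pow_succ, map_mul (HopfRep.ad (U t)), Module.End.mul_apply, ad_f_mul, map_add, ih (by omega) hx (ad_f_pow_ad_kinv_eq_zero hy'),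
      ih (by omega) (ad_f_pow_ad_k_eq_zero hx') hy, add_zero]

/-- The elementary case behind the nilpotency for all `l`: `e k⁻¹` should generate a
three-dimensional representation. Every term is brought to the order `f`, `e`, `k`, and coefficients
are compared. -/
lemma ad_f_pow_three : HopfRep.ad (U t) (f t ^ 3) (e t * kinv t) = 0 := by
  have h1 (z : U t) : k t * (kinv t * z) = z := by rw [← mul_assoc, k_mul_kinv, one_mul]
  have h2 (z : U t) : kinv t * (k t * z) = z := by rw [← mul_assoc, kinv_mul_k, one_mul]
  have hkf (z : U t) : k t * (f t * z) = ((t : ℝ) : ℂ) ^ (-2 : ℤ) • (f t * (k t * z)) := by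
    rw [← mul_assoc, k_mul_f, smul_mul_assoc, mul_assoc]
  have hke (z : U t) : k t * (e t * z) = ((t : ℝ) : ℂ) ^ (2 : ℤ) • (e t * (k t * z)) := by
    rw [← mul_assoc, k_mul_e, smul_mul_assoc, mul_assoc]
  have hef' : e t * f t = f t * e t + (((t : ℝ) : ℂ) ^ (2 : ℤ) - ((t : ℝ) : ℂ) ^ (-2 : ℤ))⁻¹ •
      (k t * k t - kinv t * kinv t) := by
    rw [← pow_two, ← pow_two, ← e_mul_f]
    abel
  have hef (z : U t) : e t * (f t * z) = f t * (e t * z) +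
      (((t : ℝ) : ℂ) ^ (2 : ℤ) - ((t : ℝ) : ℂ) ^ (-2 : ℤ))⁻¹ •
      (k t * (k t * z) - kinv t * (kinv t * z)) := by
    rw [← mul_assoc, hef', add_mul, smul_mul_assoc, sub_mul, mul_assoc, mul_assoc, mul_assoc]
  -- The cancellation does not use the value of the constant in `[e, f]`.
  generalize hd : (((t : ℝ) : ℂ) ^ (2 : ℤ) - ((t : ℝ) : ℂ) ^ (-2 : ℤ))⁻¹ = d at hef hef'
  have h0 := t_zpow t
  have hp : ((t : ℝ) : ℂ) ^ (2 : ℤ) ≠ 0 := zpow_ne_zero _ (t_ne t)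
  have hm : ((t : ℝ) : ℂ) ^ (-2 : ℤ) = (((t : ℝ) : ℂ) ^ (2 : ℤ))⁻¹ :=
    (inv_eq_of_mul_eq_one_right h0).symm
  rw [hm] at *
  simp only [pow_succ, pow_zero, one_mul, map_mul, Module.End.mul_apply, ad_f_apply, sub_mul,
    mul_sub, add_mul, mul_add, smul_mul_assoc, mul_smul_comm, mul_assoc, h1, h2, hkf, hke,
    hef, hef', k_mul_f, kinv_mul_f, k_mul_e, k_mul_kinv, kinv_mul_k, mul_one, smul_sub,
    smul_add, smul_smul]
  match_scalars <;> field_simp <;> ring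

lemma e_pow_mul_kinv_pow_succ (l : ℕ) : e t ^ (l + 1) * kinv t ^ (l + 1) =
    ((t : ℝ) : ℂ) ^ (2 * l : ℤ) • ((e t ^ l * kinv t ^ l) * (e t * kinv t)) := by
  rw [mul_assoc, ← mul_assoc (kinv t ^ l), kinv_pow_mul_e, smul_mul_assoc, mul_smul_comm,
    smul_smul, ← zpow_add₀ (t_ne t), add_neg_cancel, zpow_zero, one_smul]
  simp only [pow_succ, mul_assoc]

lemma ad_f_pow_highest (l : ℕ) :
    HopfRep.ad (U t) (f t ^ (2 * l + 1)) (e t ^ l * kinv t ^ l) = 0 := by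
  induction l with
  | zero => simp [ad_f_apply, k_mul_f, smul_smul, t_ne t]
  | succ l ih =>
    rw [e_pow_mul_kinv_pow_succ, map_smul,
      -- The orders `2l + 1` and `3` of the two factors add up to exactly `(2l + 3) + 1`.
      ad_f_pow_mul_eq_zero (2 * (l + 1) + 1) (by omega) ih ad_f_pow_three, smul_zero]

lemma ad_e_highest (l : ℕ) : HopfRep.ad (U t) (e t) (e t ^ l * kinv t ^ l) = 0 := by
  rw [ad_e_apply, ← mul_assoc (k t), k_mul_e_pow, smul_mul_assoc, smul_mul_assoc, smul_smul,
    mul_assoc (e t ^ l), (commute_k_kinv.pow_right l).eq, ← mul_assoc (e t ^ l),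
    mul_assoc _ (k t), k_mul_e, mul_smul_comm, smul_smul, mul_assoc (e t ^ l),
    ← mul_assoc (kinv t ^ l), kinv_pow_mul_e, smul_mul_assoc, mul_smul_comm, smul_smul]
  simp only [← zpow_add₀ (t_ne t)]
  rw [show (-2 : ℤ) + 2 * l + 2 + -(2 * l) = 0 by ring, zpow_zero, one_smul]
  simp only [← mul_assoc, ← pow_succ', ← pow_succ, sub_self]

lemma ad_k_highest (l : ℕ) : HopfRep.ad (U t) (k t) (e t ^ l * kinv t ^ l) =
    ((t : ℝ) : ℂ) ^ (2 * l : ℤ) • (e t ^ l * kinv t ^ l) := by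
  rw [ad_k_apply, ← mul_assoc (k t), k_mul_e_pow, smul_mul_assoc, smul_mul_assoc,
    mul_assoc (e t ^ l), (commute_k_kinv.pow_right l).eq, ← mul_assoc (e t ^ l), mul_assoc _ (k t),
    k_mul_kinv, mul_one]

lemma ad_kinv_highest (l : ℕ) : HopfRep.ad (U t) (kinv t) (e t ^ l * kinv t ^ l) =
    ((t : ℝ) : ℂ) ^ (-(2 * l : ℤ)) • (e t ^ l * kinv t ^ l) := by
  rw [ad_kinv_apply, ← mul_assoc (kinv t), kinv_mul_e_pow, smul_mul_assoc, smul_mul_assoc,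
    mul_assoc (e t ^ l), ← pow_succ', pow_succ, ← mul_assoc (e t ^ l), mul_assoc _ (kinv t),
    kinv_mul_k, mul_one]

end Adjoint

/-! ### Highest weight vectors -/

section HighestWeight

variable {t : ℝˣ} {X : Type*} [AddCommGroup X] [Module ℂ X]

lemma map_k_f_pow {ρ : U t →ₐ[ℂ] Module.End ℂ X} {v : X} {M : ℤ}
    (hk : ρ (k t) v = ((t : ℝ) : ℂ) ^ M • v) (s : ℕ) :
    ρ (k t) (ρ (f t ^ s) v) = ((t : ℝ) : ℂ) ^ (M - 2 * s) • ρ (f t ^ s) v := by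
  rw [← Module.End.mul_apply, ← map_mul, k_mul_f_pow, map_smul, map_mul, LinearMap.smul_apply,
    Module.End.mul_apply, hk, map_smul, smul_smul, ← zpow_add₀ (t_ne t), neg_add_eq_sub]

lemma map_kinv_f_pow {ρ : U t →ₐ[ℂ] Module.End ℂ X} {v : X} {M : ℤ}
    (hk : ρ (kinv t) v = ((t : ℝ) : ℂ) ^ (-M) • v) (s : ℕ) :
    ρ (kinv t) (ρ (f t ^ s) v) = ((t : ℝ) : ℂ) ^ (-(M - 2 * s)) • ρ (f t ^ s) v := by
  rw [← Module.End.mul_apply, ← map_mul, kinv_mul_f_pow, map_smul, map_mul, LinearMap.smul_apply,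
    Module.End.mul_apply, hk, map_smul, smul_smul, ← zpow_add₀ (t_ne t)]
  congr 2
  ring

/-- Moving `e` to the right through the powers of `f` produces one commutator for each power;
`qnum_identity` writes its scalar as a difference, so the contributions telescope. -/
lemma map_e_f_pow_succ {ρ : U t →ₐ[ℂ] Module.End ℂ X} {v : X} {M : ℤ}
    (he : ρ (e t) v = 0) (hk : ρ (k t) v = ((t : ℝ) : ℂ) ^ M • v)
    (hk' : ρ (kinv t) v = ((t : ℝ) : ℂ) ^ (-M) • v) (s : ℕ) :
    ρ (e t) (ρ (f t ^ (s + 1)) v) =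
      ((qnum t (s + 1) * qnum t (M - s) : ℝ) : ℂ) • ρ (f t ^ s) v := by
  have hef (x : X) : ρ (e t) (ρ (f t) x) = ρ (f t) (ρ (e t) x) +
      (((t : ℝ) : ℂ) ^ (2 : ℤ) - ((t : ℝ) : ℂ) ^ (-2 : ℤ))⁻¹ •
        (ρ (k t) (ρ (k t) x) - ρ (kinv t) (ρ (kinv t) x)) := by
    have h := congrArg (fun a => ρ a x) (e_mul_f (t := t))
    simp only [map_sub, map_mul, map_smul, pow_two, LinearMap.sub_apply, Module.End.mul_apply,
      LinearMap.smul_apply] at h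
    rw [← h]
    abel
  have key : ∀ s : ℕ, ρ (e t) (ρ (f t ^ (s + 1)) v) = ρ (f t) (ρ (e t) (ρ (f t ^ s) v)) +
      ((qnum t (s + 1) * qnum t (M - s) - qnum t s * qnum t (M - s + 1) : ℝ) : ℂ) •
        ρ (f t ^ s) v := by
    intro s
    rw [pow_succ', map_mul, Module.End.mul_apply, hef, map_k_f_pow hk, map_smul, map_k_f_pow hk,
      map_kinv_f_pow hk', map_smul, map_kinv_f_pow hk', smul_smul, smul_smul, ← sub_smul,
      smul_smul, qnum_identity, ← zpow_add₀ (t_ne t), ← zpow_add₀ (t_ne t)]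
    push_cast
    ring_nf
  induction s with
  | zero =>
    rw [key 0]
    simp [he]
  | succ s ih =>
    rw [key (s + 1), ih, map_smul, ← Module.End.mul_apply, ← map_mul, ← pow_succ', ← add_smul]
    congr 1
    push_cast
    rw [show M - ((s : ℤ) + 1) + 1 = M - s by ring]
    ring

/-- The normalization of the weight vectors obtained from a highest weight vector. -/
def hwCoeff (t : ℝˣ) (M s : ℕ) : ℝ := Real.sqrt (qfact t (M - s) / (qfact t M * qfact t s))

lemma hwCoeff_zero {t : ℝˣ} (ht : t ≠ 1) (ht' : t ≠ -1) (M : ℕ) : hwCoeff t M 0 = 1 := by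
  simp [hwCoeff, (qfact_pos ht ht' M).ne']

/-- This relation makes `f` act on the normalized vectors with exactly the coefficients of `V^j`. -/
lemma hwCoeff_succ {t : ℝˣ} (ht : t ≠ 1) (ht' : t ≠ -1) {M s : ℕ} (h : s < M) :
    hwCoeff t M (s + 1) * ladder t M s = hwCoeff t M s := by
  have h1 := qfact_pos ht ht' s
  have h2 := qfact_pos ht ht' M
  have h3 := qfact_pos ht ht' (M - (s + 1))
  have h4 : 0 < qnum t (s + 1) := qnum_pos ht ht' (by omega)
  rw [hwCoeff, hwCoeff, ladder, ← Real.sqrt_mul (by rw [qfact_succ]; positivity)]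
  congr 1
  rw [show M - s = M - (s + 1) + 1 by omega, qfact_succ, qfact_succ,
    show ((M - (s + 1) : ℕ) : ℤ) + 1 = M - s by omega]
  field_simp

/-- The map from `V^j` to a representation that is given by a vector of weight `j`. -/
def hwMap {t : ℝˣ} (M : ℕ) (ρ : U t →ₐ[ℂ] Module.End ℂ X) (v : X) : V M →ₗ[ℂ] X :=
  (Pi.basisFun ℂ (Fin (M + 1))).constr ℂ fun s => ((hwCoeff t M s : ℝ) : ℂ) • ρ (f t ^ (s : ℕ)) v

lemma hwMap_wv {M s : ℕ} (ρ : U t →ₐ[ℂ] Module.End ℂ X) (v : X) (hs : s ≤ M) :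
    hwMap M ρ v (wv M s) = ((hwCoeff t M s : ℝ) : ℂ) • ρ (f t ^ s) v := by
  have h : wv M s = Pi.basisFun ℂ (Fin (M + 1)) ⟨s, by omega⟩ := by
    rw [Pi.basisFun_apply]
    exact (wt_eq_wv M ⟨s, by omega⟩).symm
  rw [h, hwMap, Module.Basis.constr_basis]

/-- The action on the vectors `f^s v` is forced by the weight `M` and `e v = 0`; the vanishing of
`f^(M+1) v` is needed only at the lowest weight vector. -/
lemma hwMap_intertwines (ht : t ≠ 1) (ht' : t ≠ -1) {ρ : U t →ₐ[ℂ] Module.End ℂ X} {v : X} {M : ℕ}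
    (he : ρ (e t) v = 0) (hk : ρ (k t) v = ((t : ℝ) : ℂ) ^ (M : ℤ) • v)
    (hk' : ρ (kinv t) v = ((t : ℝ) : ℂ) ^ (-(M : ℤ)) • v) (hf : ρ (f t ^ (M + 1)) v = 0) (a : U t) :
    hwMap M ρ v ∘ₗ irrep t M a = ρ a ∘ₗ hwMap M ρ v := by
  refine intertwines_of_generators (linearMap_ext_wv fun s hs => ?_)
    (linearMap_ext_wv fun s hs => ?_) (linearMap_ext_wv fun s hs => ?_)
    (linearMap_ext_wv fun s hs => ?_) a <;>
    simp only [LinearMap.comp_apply]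
  · rcases s with _ | s
    · rw [irrep_e_wv_zero, map_zero, hwMap_wv _ _ hs, map_smul, pow_zero, map_one,
        Module.End.one_apply, he, smul_zero]
    · rw [irrep_e_wv_succ t (by omega), map_smul, hwMap_wv _ _ (by omega), hwMap_wv _ _ hs, map_smul,
        map_e_f_pow_succ he hk hk', smul_smul, smul_smul, ← Complex.ofReal_mul,
        ← Complex.ofReal_mul]
      congr 2
      have h := ladder_sq (t := t) (N := M) (b := s) (by omega)
      rw [← hwCoeff_succ ht ht' (show s < M by omega), mul_comm (qnum t (s + 1)), ← h]
      ring
  · rw [irrep_f_wv t hs, map_smul, hwMap_wv _ _ hs, map_smul, ← Module.End.mul_apply, ← map_mul,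
      ← pow_succ']
    rcases hs.lt_or_eq with h | rfl
    · rw [hwMap_wv _ _ (by omega), smul_smul, ← Complex.ofReal_mul, mul_comm,
        hwCoeff_succ ht ht' h]
    · rw [hf, wv_of_lt (by omega), map_zero, smul_zero, smul_zero]
  · rw [irrep_k_wv, map_smul, hwMap_wv _ _ hs, map_smul, map_k_f_pow hk, smul_comm]
  · rw [irrep_kinv_wv, map_smul, hwMap_wv _ _ hs, map_smul, map_kinv_f_pow hk', smul_comm]

end HighestWeight

/-! ### The representation `U^l` -/

/-- The intertwiner `V^l → U_t` with range `U^l`. -/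
def lamMap (t : ℝˣ) (l : ℕ) : V (2 * l) →ₗ[ℂ] U t :=
  hwMap (2 * l) (HopfRep.ad (U t)) (e t ^ l * kinv t ^ l)

lemma lamMap_wv (t : ℝˣ) {l s : ℕ} (hs : s ≤ 2 * l) : lamMap t l (wv (2 * l) s) =
    ((hwCoeff t (2 * l) s : ℝ) : ℂ) • HopfRep.ad (U t) (f t ^ s) (e t ^ l * kinv t ^ l) :=
  hwMap_wv _ _ hs

lemma lamMap_wt (t : ℝˣ) (l : ℕ) (s : Fin (2 * l + 1)) : lamMap t l (wt (2 * l) s) = lam t l s := by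
  rw [wt_eq_wv, lamMap_wv t (by omega), lam, map_pow, hwCoeff]

lemma lamMap_intertwines {t : ℝˣ} (ht : t ≠ 1) (ht' : t ≠ -1) (l : ℕ) (a : U t) :
    lamMap t l ∘ₗ irrep t (2 * l) a = HopfRep.ad (U t) a ∘ₗ lamMap t l := by
  refine hwMap_intertwines ht ht' (ad_e_highest l) ?_ ?_ (ad_f_pow_highest l) a
  · rw [ad_k_highest]
    push_cast
    rfl
  · rw [ad_kinv_highest]
    push_cast
    rfl

/-- `k^{-l}` acts on the vector of index `l` by a scalar, and `e^l` climbs from index `l` to index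
`0`. This explicit matrix element fixes all the others through the intertwining property. -/
lemma irrep_e_pow_mul_kinv_pow (t : ℝˣ) {N l : ℕ} (h : l ≤ N) :
    irrep t N (e t ^ l * kinv t ^ l) (wv N l) =
      (((t : ℝ) ^ (-(l * ((N : ℤ) - 2 * l))) * ∏ b ∈ Finset.range l, ladder t N b : ℝ) : ℂ) •
        wv N 0 := by
  have h1 : ∀ s : ℕ, irrep t N (kinv t ^ s) (wv N l) =
      ((t : ℝ) : ℂ) ^ (-(s * ((N : ℤ) - 2 * l))) • wv N l := by
    intro s
    induction s with
    | zero => simp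
    | succ s ih =>
      rw [pow_succ', map_mul, Module.End.mul_apply, ih, map_smul, irrep_kinv_wv, smul_smul,
        ← zpow_add₀ (t_ne t)]
      congr 2
      push_cast
      ring
  have h2 : ∀ s ≤ N, irrep t N (e t ^ s) (wv N s) =
      ((∏ b ∈ Finset.range s, ladder t N b : ℝ) : ℂ) • wv N 0 := by
    intro s hs
    induction s with
    | zero => simp
    | succ s ih =>
      rw [pow_succ, map_mul, Module.End.mul_apply, irrep_e_wv_succ t (by omega), map_smul,
        ih (by omega), smul_smul, Finset.prod_range_succ, ← Complex.ofReal_mul, mul_comm]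
  rw [map_mul, Module.End.mul_apply, h1, map_smul, h2 l h, smul_smul]
  push_cast
  rfl

lemma prod_ladder_pos {t : ℝˣ} (ht : t ≠ 1) (ht' : t ≠ -1) {N l : ℕ} (h : l ≤ N) :
    0 < ∏ b ∈ Finset.range l, ladder t N b :=
  Finset.prod_pos fun b hb => ladder_pos ht ht' (by have := Finset.mem_range.1 hb; omega)

lemma prod_ladder_sq {t : ℝˣ} (ht : t ≠ 1) (ht' : t ≠ -1) {N l : ℕ} (h : l ≤ N) :
    (∏ b ∈ Finset.range l, ladder t N b) ^ 2 = qfact t N / qfact t (N - l) * qfact t l := by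
  induction l with
  | zero => simp [(qfact_pos ht ht' N).ne']
  | succ l ih =>
    have h1 := (qfact_pos ht ht' (N - (l + 1))).ne'
    have h2 : qnum t ((N : ℤ) - l) ≠ 0 := qnum_ne_zero ht ht' (by omega)
    rw [Finset.prod_range_succ, mul_pow, ih (by omega), ladder_sq (by omega), qfact_succ,
      show N - l = N - (l + 1) + 1 by omega, qfact_succ,
      show ((N - (l + 1) : ℕ) : ℤ) + 1 = N - l by omega]
    field_simp

/-- No basis of `U_t` is needed: in the representation with `N = l` the element carries the lowest
weight vector to a nonzero multiple of the highest one. -/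
lemma e_pow_mul_kinv_pow_ne_zero {t : ℝˣ} (ht : t ≠ 1) (ht' : t ≠ -1) (l : ℕ) :
    e t ^ l * kinv t ^ l ≠ 0 := by
  intro h
  have h1 := congrFun (irrep_e_pow_mul_kinv_pow t (le_refl l)) 0
  rw [h, map_zero] at h1
  simp only [LinearMap.zero_apply, Pi.zero_apply, Pi.smul_apply, wv_zero_apply_zero, smul_eq_mul,
    mul_one] at h1
  exact mul_ne_zero (zpow_ne_zero _ t.ne_zero) (prod_ladder_pos ht ht' (le_refl l)).ne'
    (Complex.ofReal_eq_zero.1 h1.symm)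

lemma lamMap_ne_zero {t : ℝˣ} (ht : t ≠ 1) (ht' : t ≠ -1) (l : ℕ) : lamMap t l ≠ 0 := by
  intro h
  have h1 := lamMap_wv t (l := l) (Nat.zero_le (2 * l))
  rw [h, hwCoeff_zero ht ht', pow_zero, map_one] at h1
  exact e_pow_mul_kinv_pow_ne_zero ht ht' l (by simpa using h1.symm)

lemma lamMap_comp_basis (t : ℝˣ) (l : ℕ) :
    lamMap t l ∘ Pi.basisFun ℂ (Fin (2 * l + 1)) = lam t l := by
  ext s
  rw [← lamMap_wt]
  simp [wt]

lemma linearIndependent_lam {t : ℝˣ} (ht : t ≠ 1) (ht' : t ≠ -1) (l : ℕ) :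
    LinearIndependent ℂ (lam t l) := by
  rw [← lamMap_comp_basis]
  exact (Pi.basisFun ℂ (Fin (2 * l + 1))).linearIndependent.map' _
    (ker_eq_bot_of_irreducible (lamMap_intertwines ht ht' l) (isIrreducibleOn_irrep ht ht' _)
      (lamMap_ne_zero ht ht' l))

lemma range_lamMap (t : ℝˣ) (l : ℕ) : LinearMap.range (lamMap t l) = Ul t l := by
  rw [Ul, ← lamMap_comp_basis, Set.range_comp, Submodule.span_image, Module.Basis.span_eq,
    Submodule.map_top]

lemma isIrreducibleOn_Ul {t : ℝˣ} (ht : t ≠ 1) (ht' : t ≠ -1) (l : ℕ) :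
    HopfRep.IsIrreducibleOn (HopfRep.ad (U t)) (Ul t l) := by
  rw [← range_lamMap]
  exact isIrreducibleOn_range (lamMap_intertwines ht ht' l) (isIrreducibleOn_irrep ht ht' _)
    (lamMap_ne_zero ht ht' l)

/-! ### Tensor operators -/

/-- A representation is an intertwiner from the adjoint representation to `Hom(V, V)`. -/
lemma map_ad {t : ℝˣ} {X : Type*} [AddCommGroup X] [Module ℂ X] (ρ : U t →ₐ[ℂ] Module.End ℂ X)
    (a u : U t) : ρ (HopfRep.ad (U t) a u) = HopfRep.homRep ρ ρ a (ρ u) := by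
  rw [HopfRep.ad, HopfRep.homRep, AlgHom.comp_apply, AlgHom.comp_apply]
  -- Both sides are linear in `Δ(a)`; on `x ⊗ y` the claim is multiplicativity of `ρ` on `x u S(y)`.
  generalize Bialgebra.comulAlgHom ℂ (U t) a = z
  induction z with
  | zero => simp
  | tmul x y =>
    erw [Algebra.TensorProduct.lift_tmul, Algebra.TensorProduct.lift_tmul]
    ext v
    simp
  | add x y hx hy => simp only [map_add, LinearMap.add_apply, hx, hy]

lemma isIrreducibleTensorOperator_irrep {t : ℝˣ} (ht : t ≠ 1) (ht' : t ≠ -1) (l N : ℕ) :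
    HopfRep.IsIrreducibleTensorOperator (HopfRep.ad (U t)) (Ul t l) (irrep t N) (irrep t N)
      ((irrep t N).toLinearMap.domRestrict (Ul t l)) where
  irreducible_type := isIrreducibleOn_Ul ht ht' l
  irreducible_source := isIrreducibleOn_irrep ht ht' N
  irreducible_target := isIrreducibleOn_irrep ht ht' N
  equivariant a x y h := by
    simp only [LinearMap.domRestrict_apply, AlgHom.toLinearMap_apply]
    rw [h, map_ad]

section TensorRep

variable {t : ℝˣ} {X Y : Type*} [AddCommGroup X] [Module ℂ X] [AddCommGroup Y] [Module ℂ Y]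
  (ρ : U t →ₐ[ℂ] Module.End ℂ X) (σ : U t →ₐ[ℂ] Module.End ℂ Y) (x : X) (y : Y)

lemma tensorRep_e_tmul : HopfRep.tensorRep ρ σ (e t) (x ⊗ₜ y) =
    ρ (e t) x ⊗ₜ σ (kinv t) y + ρ (k t) x ⊗ₜ σ (e t) y := by
  simp [HopfRep.tensorRep, comul_eq, Δ, Module.endTensorEndAlgHom_apply]

lemma tensorRep_f_tmul : HopfRep.tensorRep ρ σ (f t) (x ⊗ₜ y) =
    ρ (f t) x ⊗ₜ σ (kinv t) y + ρ (k t) x ⊗ₜ σ (f t) y := by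
  simp [HopfRep.tensorRep, comul_eq, Δ, Module.endTensorEndAlgHom_apply]

lemma tensorRep_k_tmul : HopfRep.tensorRep ρ σ (k t) (x ⊗ₜ y) =
    ρ (k t) x ⊗ₜ σ (k t) y := by
  simp [HopfRep.tensorRep, comul_eq, Δ, Module.endTensorEndAlgHom_apply]

lemma tensorRep_kinv_tmul : HopfRep.tensorRep ρ σ (kinv t) (x ⊗ₜ y) =
    ρ (kinv t) x ⊗ₜ σ (kinv t) y := by
  simp [HopfRep.tensorRep, comul_eq, Δ, Module.endTensorEndAlgHom_apply]

end TensorRep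

/-- The map `λ ⊗ v ↦ π^j(λ) v` on `V^l ⊗ V^j`. -/
def lamAct (t : ℝˣ) (l N : ℕ) : V (2 * l) ⊗[ℂ] V N →ₗ[ℂ] V N :=
  TensorProduct.lift ((irrep t N).toLinearMap ∘ₗ lamMap t l)

lemma lamAct_tmul (t : ℝˣ) (l N : ℕ) (x : V (2 * l)) (y : V N) :
    lamAct t l N (x ⊗ₜ y) = irrep t N (lamMap t l x) y := by
  simp [lamAct]

/-- The reason is `∑ ad_{a₍₁₎}(u) a₍₂₎ = ∑ a₍₁₎ u S(a₍₂₎) a₍₃₎ = a u`, checked here on the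
generators. -/
lemma lamAct_intertwines {t : ℝˣ} (ht : t ≠ 1) (ht' : t ≠ -1) (l N : ℕ) (a : U t) :
    lamAct t l N ∘ₗ HopfRep.tensorRep (irrep t (2 * l)) (irrep t N) a =
      irrep t N a ∘ₗ lamAct t l N := by
  have hl (a : U t) (x : V (2 * l)) :
      lamMap t l (irrep t (2 * l) a x) = HopfRep.ad (U t) a (lamMap t l x) :=
    LinearMap.congr_fun (lamMap_intertwines ht ht' l a) x
  have hm (a b : U t) (y : V N) : irrep t N a (irrep t N b y) = irrep t N (a * b) y := by
    rw [map_mul, Module.End.mul_apply]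
  refine intertwines_of_generators (TensorProduct.ext' fun x y => ?_)
    (TensorProduct.ext' fun x y => ?_) (TensorProduct.ext' fun x y => ?_)
    (TensorProduct.ext' fun x y => ?_) a <;>
  simp only [LinearMap.comp_apply, tensorRep_e_tmul, tensorRep_f_tmul, tensorRep_k_tmul,
    tensorRep_kinv_tmul, map_add, lamAct_tmul, hl, hm, ad_e_apply, ad_f_apply, ad_k_apply,
    ad_kinv_apply, sub_mul, smul_mul_assoc, mul_assoc, k_mul_kinv, kinv_mul_k, mul_one]
  · rw [← LinearMap.add_apply, ← map_add]
    congr 2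
    have := t_zpow t
    have h : e t * kinv t = ((t : ℝ) : ℂ) ^ (2 : ℤ) • (kinv t * e t) := by
      rw [kinv_mul_e, smul_smul, this, one_smul]
    rw [h]
    simp only [mul_smul_comm, smul_smul]
    rw [mul_comm (_ ^ (-2 : ℤ)), this, one_smul, sub_add_cancel]
  · rw [← LinearMap.add_apply, ← map_add]
    congr 2
    simp only [kinv_mul_f, mul_smul_comm, sub_add_cancel]

/-! ### Intertwiners `V^κ ⊗ V^ℓ → V^j` -/

section Coupling

variable {t : ℝˣ} {K L J : ℕ} {T : V K ⊗[ℂ] V L →ₗ[ℂ] V J}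

/-- Comparison of the eigenvalues of `k`: the top coordinate has weight `J`, the tensor has weight
`(K - 2p) + (L - 2n)`. -/
lemma coupling_eq_zero_of_weight_ne (ht : t ≠ 1) (ht' : t ≠ -1)
    (hT : ∀ a : U t, T ∘ₗ HopfRep.tensorRep (irrep t K) (irrep t L) a = irrep t J a ∘ₗ T)
    {d p n : ℕ} (hd : K + L = J + 2 * d) (h : p + n ≠ d) : T (wv K p ⊗ₜ wv L n) 0 = 0 := by
  have h1 := congrFun (LinearMap.congr_fun (hT (k t)) (wv K p ⊗ₜ wv L n)) 0
  simp only [LinearMap.comp_apply, tensorRep_k_tmul, irrep_k_wv, irrep_k_apply_apply,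
    ← TensorProduct.smul_tmul', TensorProduct.tmul_smul, map_smul, smul_smul, Pi.smul_apply,
    smul_eq_mul, ← zpow_add₀ (t_ne t)] at h1
  by_contra h0
  have h2 := zpow_injective ht ht' (mul_right_cancel₀ h0 h1)
  simp only [Fin.val_zero] at h2
  omega

/-- The image of `f` has no component along the highest weight vector, so the top coordinate of `T
(f (e_p ⊗ e_n))` is zero; this is a two-term recursion along `p + n`. -/
lemma coupling_ladder
    (hT : ∀ a : U t, T ∘ₗ HopfRep.tensorRep (irrep t K) (irrep t L) a = irrep t J a ∘ₗ T)
    {p n : ℕ} (hp : p ≤ K) (hn : n ≤ L) :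
    ((ladder t K p * (t : ℝ) ^ (-((L : ℤ) - 2 * n)) : ℝ) : ℂ) * T (wv K (p + 1) ⊗ₜ wv L n) 0 +
      (((t : ℝ) ^ ((K : ℤ) - 2 * p) * ladder t L n : ℝ) : ℂ) * T (wv K p ⊗ₜ wv L (n + 1)) 0 = 0 := by
  have h1 := congrFun (LinearMap.congr_fun (hT (f t)) (wv K p ⊗ₜ wv L n)) 0
  simp only [LinearMap.comp_apply, tensorRep_f_tmul, irrep_k_wv, irrep_kinv_wv, irrep_f_wv t hp,
    irrep_f_wv t hn, irrep_f_apply_zero, ← TensorProduct.smul_tmul', TensorProduct.tmul_smul,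
    map_smul, map_add, smul_smul, Pi.smul_apply, Pi.add_apply, smul_eq_mul] at h1
  rw [← h1]
  push_cast
  ring

/-- An intertwiner is determined by a single matrix element. -/
lemma coupling_eq_zero (ht : t ≠ 1) (ht' : t ≠ -1)
    (hT : ∀ a : U t, T ∘ₗ HopfRep.tensorRep (irrep t K) (irrep t L) a = irrep t J a ∘ₗ T)
    {d : ℕ} (hd : K + L = J + 2 * d) (h0 : T (wv K 0 ⊗ₜ wv L d) 0 = 0) : T = 0 := by
  have h1 : ∀ p n, T (wv K p ⊗ₜ wv L n) 0 = 0 := by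
    intro p
    induction p with
    | zero =>
      intro n
      by_cases hn : n = d
      · rw [hn, h0]
      · exact coupling_eq_zero_of_weight_ne ht ht' hT hd (by omega)
    | succ p ih =>
      intro n
      by_cases hp : p < K
      · by_cases hn : n ≤ L
        · have h2 := coupling_ladder hT hp.le hn
          rw [ih, mul_zero, add_zero, mul_eq_zero, Complex.ofReal_eq_zero] at h2
          exact h2.resolve_left
            (mul_ne_zero (ladder_pos ht ht' hp).ne' (zpow_ne_zero _ t.ne_zero))
        · rw [wv_of_lt (N := L) (by omega), TensorProduct.tmul_zero, map_zero, Pi.zero_apply]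
      · rw [wv_of_lt (N := K) (by omega), TensorProduct.zero_tmul, map_zero, Pi.zero_apply]
  have h2 : ∀ x, T x 0 = 0 := by
    intro x
    have h3 : (LinearMap.proj (0 : Fin (J + 1)) : V J →ₗ[ℂ] ℂ) ∘ₗ T = 0 :=
      TensorProduct.ext (linearMap_ext_wv fun p _ => linearMap_ext_wv fun n _ => h1 p n)
    exact LinearMap.congr_fun h3 x
  -- Coordinate `m` of `e (T x) = T (e x)` is a nonzero multiple of coordinate `m + 1` of `T x`, so
  -- vanishing passes from each row to the next.
  have h3 : ∀ m : ℕ, ∀ hm : m < J + 1, ∀ x, T x ⟨m, hm⟩ = 0 := by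
    intro m
    induction m with
    | zero => exact fun _ x => h2 x
    | succ m ih =>
      intro hm x
      have h4 := congrFun (LinearMap.congr_fun (hT (e t)) x) ⟨m, by omega⟩
      simp only [LinearMap.comp_apply] at h4
      rw [ih, irrep_e_apply_apply t (T x) (j := ⟨m + 1, hm⟩) rfl, eq_comm, mul_eq_zero,
        Complex.ofReal_eq_zero] at h4
      exact h4.resolve_left (ladder_pos ht ht' (by simp; omega)).ne'
  refine LinearMap.ext fun x => funext fun m => ?_
  exact h3 m m.2 x

/-! ### Transposes and orthogonality of the rows of an intertwiner -/

lemma eMat_transpose (t : ℝˣ) (N : ℕ) : (eMat t N).transpose = fMat t N := by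
  ext a b
  simp only [Matrix.transpose_apply, eMat_apply, fMat_apply, eq_comm]

lemma fMat_transpose (t : ℝˣ) (N : ℕ) : (fMat t N).transpose = eMat t N := by
  rw [← eMat_transpose, Matrix.transpose_transpose]

lemma kMat_transpose (t : ℝˣ) (N : ℕ) (σ : ℤ) : (kMat t N σ).transpose = kMat t N σ :=
  Matrix.diagonal_transpose _

lemma toMatrix_tensorRep_e (t : ℝˣ) (K L : ℕ) :
    LinearMap.toMatrix ((Pi.basisFun ℂ (Fin (K + 1))).tensorProduct (Pi.basisFun ℂ (Fin (L + 1))))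
      ((Pi.basisFun ℂ (Fin (K + 1))).tensorProduct (Pi.basisFun ℂ (Fin (L + 1))))
      (HopfRep.tensorRep (irrep t K) (irrep t L) (e t)) =
    Matrix.kroneckerMap (· * ·) (eMat t K) (kMat t L (-1)) +
      Matrix.kroneckerMap (· * ·) (kMat t K 1) (eMat t L) := by
  have h : HopfRep.tensorRep (irrep t K) (irrep t L) (e t) =
      TensorProduct.map (Matrix.toLin' (eMat t K)) (Matrix.toLin' (kMat t L (-1))) +
        TensorProduct.map (Matrix.toLin' (kMat t K 1)) (Matrix.toLin' (eMat t L)) := by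
    refine TensorProduct.ext' fun x y => ?_
    rw [tensorRep_e_tmul]
    simp [irrep_e_apply, irrep_k_apply, irrep_kinv_apply]
  rw [h, map_add, TensorProduct.toMatrix_map, TensorProduct.toMatrix_map]
  simp only [LinearMap.toMatrix_eq_toMatrix', LinearMap.toMatrix'_toLin']

lemma toMatrix_tensorRep_f (t : ℝˣ) (K L : ℕ) :
    LinearMap.toMatrix ((Pi.basisFun ℂ (Fin (K + 1))).tensorProduct (Pi.basisFun ℂ (Fin (L + 1))))
      ((Pi.basisFun ℂ (Fin (K + 1))).tensorProduct (Pi.basisFun ℂ (Fin (L + 1))))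
      (HopfRep.tensorRep (irrep t K) (irrep t L) (f t)) =
    Matrix.kroneckerMap (· * ·) (fMat t K) (kMat t L (-1)) +
      Matrix.kroneckerMap (· * ·) (kMat t K 1) (fMat t L) := by
  have h : HopfRep.tensorRep (irrep t K) (irrep t L) (f t) =
      TensorProduct.map (Matrix.toLin' (fMat t K)) (Matrix.toLin' (kMat t L (-1))) +
        TensorProduct.map (Matrix.toLin' (kMat t K 1)) (Matrix.toLin' (fMat t L)) := by
    refine TensorProduct.ext' fun x y => ?_
    rw [tensorRep_f_tmul]
    simp [irrep_f_apply, irrep_k_apply, irrep_kinv_apply]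
  rw [h, map_add, TensorProduct.toMatrix_map, TensorProduct.toMatrix_map]
  simp only [LinearMap.toMatrix_eq_toMatrix', LinearMap.toMatrix'_toLin']

lemma irrep_e_eq_toLin' (t : ℝˣ) (N : ℕ) : irrep t N (e t) = Matrix.toLin' (eMat t N) := by
  refine LinearMap.ext fun x => ?_
  rw [irrep_e_apply, Matrix.toLin'_apply]

lemma irrep_f_eq_toLin' (t : ℝˣ) (N : ℕ) : irrep t N (f t) = Matrix.toLin' (fMat t N) := by
  refine LinearMap.ext fun x => ?_
  rw [irrep_f_apply, Matrix.toLin'_apply]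

/-- The rows of the matrix of an intertwiner are orthogonal and of the same length. -/
lemma coupling_orthogonal (ht : t ≠ 1) (ht' : t ≠ -1)
    (hT : ∀ a : U t, T ∘ₗ HopfRep.tensorRep (irrep t K) (irrep t L) a = irrep t J a ∘ₗ T)
    (m m' : Fin (J + 1)) :
    ∑ p, ∑ n, T (wt K p ⊗ₜ wt L n) m * T (wt K p ⊗ₜ wt L n) m' =
      if m = m' then ∑ p, ∑ n, T (wt K p ⊗ₜ wt L n) 0 * T (wt K p ⊗ₜ wt L n) 0 else 0 := by
  set B := (Pi.basisFun ℂ (Fin (K + 1))).tensorProduct (Pi.basisFun ℂ (Fin (L + 1))) with hB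
  set M := LinearMap.toMatrix B (Pi.basisFun ℂ (Fin (J + 1))) T with hM
  have hMa : ∀ m x, M m x = T (wt K x.1 ⊗ₜ wt L x.2) m := by
    intro m x
    simp [hM, hB, LinearMap.toMatrix_apply, Module.Basis.tensorProduct_apply', wt]
  have hG : ∀ m m', (M * M.transpose) m m' =
      ∑ p, ∑ n, T (wt K p ⊗ₜ wt L n) m * T (wt K p ⊗ₜ wt L n) m' := by
    intro m m'
    simp only [Matrix.mul_apply, Matrix.transpose_apply, Fintype.sum_prod_type, hMa]
  have hE := congrArg (LinearMap.toMatrix B (Pi.basisFun ℂ (Fin (J + 1)))) (hT (e t))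
  have hF := congrArg (LinearMap.toMatrix B (Pi.basisFun ℂ (Fin (J + 1)))) (hT (f t))
  rw [LinearMap.toMatrix_comp B B, LinearMap.toMatrix_comp B (Pi.basisFun ℂ (Fin (J + 1))),
    toMatrix_tensorRep_e, irrep_e_eq_toLin', LinearMap.toMatrix_eq_toMatrix',
    LinearMap.toMatrix'_toLin', ← hM] at hE
  rw [LinearMap.toMatrix_comp B B, LinearMap.toMatrix_comp B (Pi.basisFun ℂ (Fin (J + 1))),
    toMatrix_tensorRep_f, irrep_f_eq_toLin', LinearMap.toMatrix_eq_toMatrix',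
    LinearMap.toMatrix'_toLin', ← hM] at hF
  have hE' := congrArg Matrix.transpose hE
  have hF' := congrArg Matrix.transpose hF
  simp only [Matrix.transpose_mul, Matrix.transpose_add, ← Matrix.kroneckerMap_transpose,
    eMat_transpose, kMat_transpose] at hE'
  simp only [Matrix.transpose_mul, Matrix.transpose_add, ← Matrix.kroneckerMap_transpose,
    fMat_transpose, kMat_transpose] at hF'
  -- The transposed relation for `f` reads `Δ(e) Mᵀ = Mᵀ e`; combined with `M Δ(e) = e M` it lets
  -- `e` pass through `M Mᵀ`.
  have cE : M * M.transpose * eMat t J = eMat t J * (M * M.transpose) := by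
    rw [Matrix.mul_assoc, ← hF', ← Matrix.mul_assoc, hE, Matrix.mul_assoc]
  have cF : M * M.transpose * fMat t J = fMat t J * (M * M.transpose) := by
    rw [Matrix.mul_assoc, ← hE', ← Matrix.mul_assoc, hF, Matrix.mul_assoc]
  obtain ⟨c, hc⟩ := exists_eq_smul_of_commute ht ht' (G := Matrix.toLin' (M * M.transpose))
    (by rw [irrep_e_eq_toLin', Module.End.mul_eq_comp, Module.End.mul_eq_comp,
      ← Matrix.toLin'_mul, ← Matrix.toLin'_mul, cE])
    (by rw [irrep_f_eq_toLin', Module.End.mul_eq_comp, Module.End.mul_eq_comp,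
      ← Matrix.toLin'_mul, ← Matrix.toLin'_mul, cF])
  have hc' : ∀ m m', (M * M.transpose) m m' = if m = m' then c else 0 := by
    intro m m'
    have h := congrFun (hc (Pi.single m' 1)) m
    rw [Matrix.toLin'_apply] at h
    simpa [Pi.single_apply] using h
  rw [← hG, ← hG, hc', hc', if_pos rfl]

end Coupling

/-! ### Uniqueness of the Clebsch-Gordan coefficients -/

namespace IsClebschGordan

variable {t : ℝˣ} {K L J d : ℕ} {C C' : Fin (K + 1) → Fin (L + 1) → Fin (J + 1) → ℝ}

lemma apply_of_hom {T : V K ⊗[ℂ] V L →ₗ[ℂ] V J}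
    (hTC : ∀ p n, T (wt K p ⊗ₜ[ℂ] wt L n) = ∑ m, (C p n m : ℂ) • wt J m) (p : Fin (K + 1))
    (n : Fin (L + 1)) (m : Fin (J + 1)) : T (wt K p ⊗ₜ wt L n) m = C p n m := by
  rw [hTC]
  simp [wt, Pi.single_apply]

/-- For `d > L` the tensor that determines the intertwiner is zero, so all coefficients vanish,
against orthonormality. -/
lemma le_right (ht : t ≠ 1) (ht' : t ≠ -1) (hd : K + L = J + 2 * d)
    (hC : IsClebschGordan t K L J C) : d ≤ L := by
  by_contra h
  obtain ⟨T, hTC, hT⟩ := hC.exists_hom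
  have h0 : T = 0 := coupling_eq_zero ht ht' hT hd (by
    rw [wv_of_lt (N := L) (by omega), TensorProduct.tmul_zero, map_zero, Pi.zero_apply])
  have h1 : ∀ p n m, C p n m = 0 := by
    intro p n m
    have h2 := apply_of_hom hTC p n m
    rw [h0] at h2
    exact (Complex.ofReal_eq_zero.1 h2.symm)
  have h2 := hC.orthonormal 0 0
  simp [h1] at h2

/-- The combination of the two intertwiners that kills the determining matrix element is zero, so
the families are proportional. Equal length of the top rows leaves a sign, which the phase condition
fixes. -/
lemma unique (ht : t ≠ 1) (ht' : t ≠ -1) (hd : K + L = J + 2 * d)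
    (hC : IsClebschGordan t K L J C) (hC' : IsClebschGordan t K L J C') : C = C' := by
  have hdL := hC.le_right ht ht' hd
  obtain ⟨T, hTC, hT⟩ := hC.exists_hom
  obtain ⟨T', hTC', hT'⟩ := hC'.exists_hom
  set n : Fin (L + 1) := ⟨d, by omega⟩ with hn
  have hp := hC.phase n hd
  have hp' := hC'.phase n hd
  have h0 : ((C' 0 n 0 : ℂ) • T - (C 0 n 0 : ℂ) • T') = 0 := by
    refine coupling_eq_zero ht ht' (fun a => ?_) hd ?_
    · rw [LinearMap.sub_comp, LinearMap.comp_sub, LinearMap.smul_comp, LinearMap.smul_comp,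
        LinearMap.comp_smul, LinearMap.comp_smul, hT, hT']
    · have h1 : wv K 0 = wt K 0 := (wt_eq_wv K 0).symm
      have h2 : wv L d = wt L n := (wt_eq_wv L n).symm
      rw [h1, h2, LinearMap.sub_apply, LinearMap.smul_apply, LinearMap.smul_apply, Pi.sub_apply,
        Pi.smul_apply, Pi.smul_apply, apply_of_hom hTC, apply_of_hom hTC', smul_eq_mul, smul_eq_mul]
      ring
  have h1 : ∀ p q m, C' 0 n 0 * C p q m = C 0 n 0 * C' p q m := by
    intro p q m
    have h2 := congrFun (LinearMap.congr_fun h0 (wt K p ⊗ₜ wt L q)) m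
    rw [LinearMap.sub_apply, LinearMap.smul_apply, LinearMap.smul_apply, Pi.sub_apply,
      Pi.smul_apply, Pi.smul_apply, apply_of_hom hTC, apply_of_hom hTC', smul_eq_mul,
      smul_eq_mul] at h2
    have h3 := sub_eq_zero.1 h2
    exact_mod_cast h3
  have h2 : (C' 0 n 0) ^ 2 = (C 0 n 0) ^ 2 := by
    have e1 := hC.orthonormal 0 0
    have e2 := hC'.orthonormal 0 0
    rw [if_pos rfl] at e1 e2
    calc (C' 0 n 0) ^ 2 = ∑ p, ∑ q, (C' 0 n 0 * C p q 0) * (C' 0 n 0 * C p q 0) := by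
          rw [← mul_one ((C' 0 n 0) ^ 2), ← e1, Finset.mul_sum]
          refine Finset.sum_congr rfl fun p _ => ?_
          rw [Finset.mul_sum]
          refine Finset.sum_congr rfl fun q _ => ?_
          ring
      _ = ∑ p, ∑ q, (C 0 n 0 * C' p q 0) * (C 0 n 0 * C' p q 0) := by simp only [h1]
      _ = (C 0 n 0) ^ 2 := by
          rw [← mul_one ((C 0 n 0) ^ 2), ← e2, Finset.mul_sum]
          refine Finset.sum_congr rfl fun p _ => ?_
          rw [Finset.mul_sum]
          refine Finset.sum_congr rfl fun q _ => ?_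
          ring
  have h3 : C' 0 n 0 = C 0 n 0 := by
    rcases eq_or_eq_neg_of_sq_eq_sq _ _ h2 with h | h
    · exact h
    · rw [h, mul_neg] at hp'
      linarith
  have h4 : C 0 n 0 ≠ 0 := fun h => by simp [h] at hp
  ext p q m
  have h5 := h1 p q m
  rw [h3] at h5
  exact mul_left_cancel₀ h4 h5

end IsClebschGordan

/-! ### Reality of the matrix elements -/

/-- The elements of `U_t` with real matrix elements in `V^j`. -/
def realElements (t : ℝˣ) (N : ℕ) : Subring (U t) :=
  (Complex.ofRealHom.mapMatrix (m := Fin (N + 1))).range.comap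
    (((Matrix.toLinAlgEquiv' : Matrix (Fin (N + 1)) (Fin (N + 1)) ℂ ≃ₐ[ℂ] _).symm.toAlgHom.comp
      (irrep t N) : U t →ₐ[ℂ] Matrix (Fin (N + 1)) (Fin (N + 1)) ℂ) : U t →+* _)

lemma mem_realElements {t : ℝˣ} {N : ℕ} {a : U t} :
    a ∈ realElements t N ↔ ∀ m n, ∃ r : ℝ, matEl t N a m n = r := by
  have h : ∀ m n, (Matrix.toLinAlgEquiv' : Matrix (Fin (N + 1)) (Fin (N + 1)) ℂ ≃ₐ[ℂ] _).symm
      (irrep t N a) m n = matEl t N a m n := by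
    intro m n
    simp [matEl, wt, Matrix.toLinAlgEquiv'_symm, LinearMap.toMatrixAlgEquiv'_apply]
  constructor
  · rintro ⟨A, hA⟩ m n
    refine ⟨A m n, ?_⟩
    rw [← h]
    exact (congrFun (congrFun hA m) n).symm
  · intro hr
    choose A hA using hr
    refine ⟨Matrix.of A, ?_⟩
    ext m n
    exact (hA m n).symm.trans (h m n).symm

lemma smul_mem_realElements {t : ℝˣ} {N : ℕ} {a : U t} (c : ℝ) (ha : a ∈ realElements t N) :
    (c : ℂ) • a ∈ realElements t N := by
  rw [mem_realElements] at ha ⊢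
  intro m n
  obtain ⟨r, hr⟩ := ha m n
  refine ⟨c * r, ?_⟩
  rw [matEl] at hr ⊢
  rw [map_smul, LinearMap.smul_apply, Pi.smul_apply, hr, smul_eq_mul, Complex.ofReal_mul]

lemma wv_apply_real (N s : ℕ) (m : Fin (N + 1)) : ∃ r : ℝ, wv N s m = r :=
  ⟨if (m : ℕ) = s then 1 else 0, by simp only [wv]; split_ifs <;> simp⟩

lemma e_mem_realElements (t : ℝˣ) (N : ℕ) : e t ∈ realElements t N := by
  rw [mem_realElements]
  intro m n
  rw [matEl, irrep_e_apply, wt, Matrix.mulVec_single_one, Matrix.col_apply, eMat_apply]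
  split_ifs
  exacts [⟨_, rfl⟩, ⟨0, by simp⟩]

lemma f_mem_realElements (t : ℝˣ) (N : ℕ) : f t ∈ realElements t N := by
  rw [mem_realElements]
  intro m n
  rw [matEl, irrep_f_apply, wt, Matrix.mulVec_single_one, Matrix.col_apply, fMat_apply]
  split_ifs
  exacts [⟨_, rfl⟩, ⟨0, by simp⟩]

lemma k_mem_realElements (t : ℝˣ) (N : ℕ) : k t ∈ realElements t N := by
  rw [mem_realElements]
  intro m n
  obtain ⟨r, hr⟩ := wv_apply_real N n m
  refine ⟨(t : ℝ) ^ ((N : ℤ) - 2 * (n : ℕ)) * r, ?_⟩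
  rw [matEl, wt_eq_wv, irrep_k_wv, Pi.smul_apply, hr, smul_eq_mul]
  push_cast
  rfl

lemma kinv_mem_realElements (t : ℝˣ) (N : ℕ) : kinv t ∈ realElements t N := by
  rw [mem_realElements]
  intro m n
  obtain ⟨r, hr⟩ := wv_apply_real N n m
  refine ⟨(t : ℝ) ^ (-((N : ℤ) - 2 * (n : ℕ))) * r, ?_⟩
  rw [matEl, wt_eq_wv, irrep_kinv_wv, Pi.smul_apply, hr, smul_eq_mul]
  push_cast
  rfl

/-- The generators have real matrices and `ad_f` combines them with real scalars. Reality is needed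
because Clebsch–Gordan coefficients are real by definition. -/
lemma lam_mem_realElements (t : ℝˣ) (N l : ℕ) (s : Fin (2 * l + 1)) :
    lam t l s ∈ realElements t N := by
  refine smul_mem_realElements _ ?_
  induction (s : ℕ) with
  | zero =>
    exact mul_mem (pow_mem (e_mem_realElements t N) l) (pow_mem (kinv_mem_realElements t N) l)
  | succ s ih =>
    rw [pow_succ', Module.End.mul_apply, ad_f_apply, ← Complex.ofReal_zpow]
    exact sub_mem (mul_mem (mul_mem (f_mem_realElements t N) ih) (k_mem_realElements t N))
      (smul_mem_realElements _
        (mul_mem (mul_mem (k_mem_realElements t N) ih) (f_mem_realElements t N)))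

/-! ### The reduced matrix element -/

lemma reducedMatrixElement_pos {t : ℝˣ} (ht : t ≠ 1) (ht' : t ≠ -1) (l N : ℕ) :
    0 < reducedMatrixElement t l N := by
  have h0 : 0 < (t : ℝ) ^ (l * (l + 1)) :=
    (Nat.even_mul_succ_self l).pow_pos t.ne_zero
  have h1 := qfact_pos ht ht' l
  have h2 := qfact_pos ht ht' (N + l + 1)
  have h3 := qfact_pos ht ht' (2 * l)
  have h4 := qfact_pos ht ht' (N - l)
  have h5 : 0 < qnum t (N + 1) := qnum_pos ht ht' (by omega)
  rw [reducedMatrixElement]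
  positivity

/-- The squares of the matrix elements of an intertwiner `V^l ⊗ V^j → V^j` in the row of highest
weight. -/
lemma coupling_sq {t : ℝˣ} (ht : t ≠ 1) (ht' : t ≠ -1) {l N : ℕ} (hl : l ≤ N)
    {T : V (2 * l) ⊗[ℂ] V N →ₗ[ℂ] V N}
    (hT : ∀ a : U t, T ∘ₗ HopfRep.tensorRep (irrep t (2 * l)) (irrep t N) a = irrep t N a ∘ₗ T)
    {r : ℕ → ℕ → ℝ} (hr : ∀ p n, T (wv (2 * l) p ⊗ₜ wv N n) 0 = r p n) {p n : ℕ}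
    (h : p + n = l) : r p n ^ 2 * qmulti t (l + 1) l =
      r 0 l ^ 2 * ((t : ℝ) ^ (2 * (N + 2) * p) *
        (qmulti t (N - l + 1) p * qmulti t (l + 1) n)) := by
  have h0 : (t : ℝ) ≠ 0 := t.ne_zero
  induction p generalizing n with
  | zero =>
    obtain rfl : n = l := by omega
    simp
  | succ p ih =>
    have h1 := ih (n := n + 1) (by omega)
    have h2 := coupling_ladder hT (p := p) (n := n) (by omega) (by omega)
    rw [hr, hr] at h2
    have h3 : ladder t (2 * l) p * (t : ℝ) ^ (-((N : ℤ) - 2 * n)) * r (p + 1) n +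
        (t : ℝ) ^ (((2 * l : ℕ) : ℤ) - 2 * p) * ladder t N n * r p (n + 1) = 0 := by
      rw [← Complex.ofReal_mul, ← Complex.ofReal_mul, ← Complex.ofReal_add] at h2
      exact Complex.ofReal_eq_zero.1 h2
    -- Squaring the recursion removes its sign and turns the square roots into `q`-numbers; by `p +
    -- 1 + n = l` the powers of `t` combine to `t^(2(N+2))`.
    have h4 : (ladder t (2 * l) p ^ 2) * r (p + 1) n ^ 2 =
        (t : ℝ) ^ (2 * (N + 2)) * ladder t N n ^ 2 * r p (n + 1) ^ 2 := by
      have e0 : (t : ℝ) ^ (-((N : ℤ) - 2 * n)) ≠ 0 := zpow_ne_zero _ h0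
      have e1 : (t : ℝ) ^ (2 * (N + 2)) * ((t : ℝ) ^ (-((N : ℤ) - 2 * n))) ^ 2 =
          ((t : ℝ) ^ (((2 * l : ℕ) : ℤ) - 2 * p)) ^ 2 := by
        simp only [← zpow_natCast, ← zpow_mul, ← zpow_add₀ h0]
        congr 1
        rw [← h]
        push_cast
        ring
      refine mul_right_cancel₀ (pow_ne_zero 2 e0) ?_
      linear_combination (ladder t (2 * l) p * (t : ℝ) ^ (-((N : ℤ) - 2 * n)) * r (p + 1) n -
        (t : ℝ) ^ (((2 * l : ℕ) : ℤ) - 2 * p) * ladder t N n * r p (n + 1)) * h3 -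
        ladder t N n ^ 2 * r p (n + 1) ^ 2 * e1
    rw [ladder_sq (by omega), ladder_sq (by omega)] at h4
    -- The ratio `[N-n][n+1] / ([p+1][2l-p])` of consecutive squares, up to the power of `t`, is
    -- that of consecutive products of `q`-multiset coefficients.
    have h5 := qmulti_succ_right ht ht' (N - l + 1) p
    have h6 := qmulti_succ_right ht ht' (l + 1) n
    have e5 : (((N - l + 1 : ℕ) : ℤ) + p) = N - n := by omega
    have e6 : (((l + 1 : ℕ) : ℤ) + n) = ((2 * l : ℕ) : ℤ) - p := by omega
    rw [e5] at h5
    rw [e6] at h6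
    have n1 : qnum t (((2 * l : ℕ) : ℤ) - p) ≠ 0 := qnum_ne_zero ht ht' (by omega)
    have n2 : qnum t (p + 1) ≠ 0 := qnum_ne_zero ht ht' (by omega)
    refine mul_right_cancel₀ (mul_ne_zero n1 n2) ?_
    have e7 : (t : ℝ) ^ (2 * (N + 2) * (p + 1)) =
        (t : ℝ) ^ (2 * (N + 2)) * (t : ℝ) ^ (2 * (N + 2) * p) := by
      rw [← pow_add]
      congr 1
      ring
    rw [e7]
    linear_combination qmulti t (l + 1) l * h4 +
      (t : ℝ) ^ (2 * (N + 2)) * qnum t (N - n) * qnum t (n + 1) * h1 +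
      r 0 l ^ 2 * ((t : ℝ) ^ (2 * (N + 2)) * (t : ℝ) ^ (2 * (N + 2) * p)) *
        (qnum t (N - n) * qmulti t (N - l + 1) p * h6 -
          qnum t (((2 * l : ℕ) : ℤ) - p) * qmulti t (l + 1) n * h5)

/-- The sum of squares in the row of highest weight. -/
lemma sum_coupling_sq {t : ℝˣ} (ht : t ≠ 1) (ht' : t ≠ -1) {l N : ℕ} (hl : l ≤ N)
    {T : V (2 * l) ⊗[ℂ] V N →ₗ[ℂ] V N}
    (hT : ∀ a : U t, T ∘ₗ HopfRep.tensorRep (irrep t (2 * l)) (irrep t N) a = irrep t N a ∘ₗ T)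
    {r : ℕ → ℕ → ℝ} (hr : ∀ p n, T (wv (2 * l) p ⊗ₜ wv N n) 0 = r p n) :
    (∑ p : Fin (2 * l + 1), ∑ n : Fin (N + 1), r p n ^ 2) * qmulti t (l + 1) l =
      r 0 l ^ 2 * ((t : ℝ) ^ (2 * l * (N - l + 1)) * qmulti t (N + 2) l) := by
  have h1 : ∑ p : Fin (2 * l + 1), ∑ n : Fin (N + 1), r p n ^ 2 =
      ∑ x ∈ Finset.HasAntidiagonal.antidiagonal l, r x.1 x.2 ^ 2 := by
    have e1 : ∀ p, ∑ n : Fin (N + 1), r p n ^ 2 = ∑ n ∈ Finset.range (N + 1), r p n ^ 2 :=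
      fun p => (Finset.sum_range (fun n => r p n ^ 2)).symm
    simp only [e1]
    rw [← Finset.sum_range (fun p => ∑ n ∈ Finset.range (N + 1), r p n ^ 2),
      ← Finset.sum_product' (Finset.range (2 * l + 1)) (Finset.range (N + 1))
      (fun p n => r p n ^ 2)]
    symm
    refine Finset.sum_subset ?_ ?_
    · intro x hx
      have := Finset.HasAntidiagonal.mem_antidiagonal.1 hx
      simp only [Finset.mem_product, Finset.mem_range]
      omega
    · intro x _ hx
      have h2 := coupling_eq_zero_of_weight_ne ht ht' hT (d := l) (p := x.1) (n := x.2)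
        (by omega) (fun h => hx (Finset.HasAntidiagonal.mem_antidiagonal.2 h))
      rw [hr, Complex.ofReal_eq_zero] at h2
      rw [h2]
      ring
  -- By weights only `p + n = l` contributes, so this is `q`-Vandermonde with `a = N - l + 1` and `b
  -- = l`.
  have h2 := sum_antidiagonal_qmulti ht ht' l l (N - l + 1)
  rw [show N - l + 1 + l + 1 = N + 2 by omega] at h2
  rw [h1, Finset.sum_mul, ← h2, Finset.mul_sum]
  refine Finset.sum_congr rfl fun x hx => ?_
  exact coupling_sq ht ht' hl hT hr (Finset.HasAntidiagonal.mem_antidiagonal.1 hx)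

lemma lamAct_highest {t : ℝˣ} (ht : t ≠ 1) (ht' : t ≠ -1) {l N : ℕ} (hl : l ≤ N) :
    lamAct t l N (wv (2 * l) 0 ⊗ₜ wv N l) 0 =
      (((t : ℝ) ^ (-(l * ((N : ℤ) - 2 * l))) * ∏ b ∈ Finset.range l, ladder t N b : ℝ) : ℂ) := by
  rw [lamAct_tmul, lamMap_wv t (Nat.zero_le _), hwCoeff_zero ht ht', pow_zero, map_one,
    Module.End.one_apply, Complex.ofReal_one, one_smul, irrep_e_pow_mul_kinv_pow t hl,
    Pi.smul_apply, wv_zero_apply_zero, smul_eq_mul, mul_one]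

/-- This is where `α` comes from: it is the length of the top row obtained from `sum_coupling_sq`
for the action of `U^l`. The powers of `t` agree because `-2l(N-2l) + 2l(N-l+1) = 2l(l+1)`. -/
lemma reducedMatrixElement_sq {t : ℝˣ} (ht : t ≠ 1) (ht' : t ≠ -1) {l N : ℕ} (hl : l ≤ N) :
    reducedMatrixElement t l N ^ 2 * qmulti t (l + 1) l =
      ((t : ℝ) ^ (-(l * ((N : ℤ) - 2 * l))) * ∏ b ∈ Finset.range l, ladder t N b) ^ 2 *
        ((t : ℝ) ^ (2 * l * (N - l + 1)) * qmulti t (N + 2) l) := by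
  have h0 : (t : ℝ) ≠ 0 := t.ne_zero
  have h1 := qfact_pos ht ht' l
  have h2 := qfact_pos ht ht' (N + l + 1)
  have h3 := qfact_pos ht ht' (2 * l)
  have h4 := qfact_pos ht ht' (N - l)
  have h5 : 0 < qnum t (N + 1) := qnum_pos ht ht' (by omega)
  have h6 := qfact_pos ht ht' N
  rw [reducedMatrixElement, mul_pow, mul_pow, Real.sq_sqrt (by positivity), mul_pow,
    prod_ladder_sq ht ht' hl, qmulti_eq ht ht', qmulti_eq ht ht', qfact_succ t N,
    show N + 1 + l = N + l + 1 by ring, show l + l = 2 * l by ring]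
  have e1 : ((t : ℝ) ^ (l * (l + 1))) ^ 2 =
      ((t : ℝ) ^ (-(l * ((N : ℤ) - 2 * l)))) ^ 2 * (t : ℝ) ^ (2 * l * (N - l + 1)) := by
    simp only [← zpow_natCast, ← zpow_mul, ← zpow_add₀ h0]
    congr 1
    push_cast [Nat.cast_sub hl]
    ring
  rw [e1]
  field_simp

/-- The matrix elements of `λ^l_p`, divided by `α`, are Clebsch-Gordan coefficients. -/
lemma isClebschGordan_matEl {t : ℝˣ} (ht : t ≠ 1) (ht' : t ≠ -1) {l N : ℕ} (hl : l ≤ N)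
    {R : Fin (2 * l + 1) → Fin (N + 1) → Fin (N + 1) → ℝ}
    (hR : ∀ p n m, matEl t N (lam t l p) m n = R p n m) :
    IsClebschGordan t (2 * l) N N fun p n m => R p n m / reducedMatrixElement t l N := by
  set α := reducedMatrixElement t l N with hα
  have hα0 : 0 < α := reducedMatrixElement_pos ht ht' l N
  have hT := lamAct_intertwines ht ht' l N
  have hTR : ∀ p n m, lamAct t l N (wt (2 * l) p ⊗ₜ wt N n) m = R p n m := by
    intro p n m
    rw [lamAct_tmul, lamMap_wt, ← hR, matEl]
  have htop := lamAct_highest ht ht' hl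
  set β : ℝ := (t : ℝ) ^ (-(l * ((N : ℤ) - 2 * l))) * ∏ b ∈ Finset.range l, ladder t N b with hβ
  have hsum : ∑ p, ∑ n, R p n 0 * R p n 0 = α ^ 2 := by
    -- The top row is extended to all natural indices, with value zero outside the range, as the
    -- recursion requires.
    set r : ℕ → ℕ → ℝ := fun p n => (lamAct t l N (wv (2 * l) p ⊗ₜ wv N n) 0).re with hr
    have hrR : ∀ (p : Fin (2 * l + 1)) (n : Fin (N + 1)), r p n = R p n 0 := by
      intro p n
      simp only [hr]
      rw [← wt_eq_wv, ← wt_eq_wv, hTR, Complex.ofReal_re]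
    have hr' : ∀ p n, lamAct t l N (wv (2 * l) p ⊗ₜ wv N n) 0 = r p n := by
      intro p n
      by_cases hp : p ≤ 2 * l
      · by_cases hn : n ≤ N
        · have e1 := hTR ⟨p, by omega⟩ ⟨n, by omega⟩ 0
          rw [wt_eq_wv, wt_eq_wv] at e1
          simp only [hr]
          rw [e1, Complex.ofReal_re]
        · simp [hr, wv_of_lt (not_le.1 hn)]
      · simp [hr, wv_of_lt (not_le.1 hp)]
    have hβ' : r 0 l = β := by
      simp only [hr]
      rw [htop, Complex.ofReal_re]
    have h1 := sum_coupling_sq ht ht' hl hT hr'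
    rw [hβ', ← reducedMatrixElement_sq ht ht' hl] at h1
    have hq : qmulti t (l + 1) l ≠ 0 := by
      rw [qmulti_eq ht ht']
      exact (div_pos (qfact_pos ht ht' _)
        (mul_pos (qfact_pos ht ht' _) (qfact_pos ht ht' _))).ne'
    rw [← mul_right_cancel₀ hq h1]
    simp only [hrR, pow_two]
  refine ⟨⟨((α⁻¹ : ℝ) : ℂ) • lamAct t l N, fun p n => ?_, fun a => ?_⟩, fun m m' => ?_,
    fun n hn => ?_⟩
  · ext m
    rw [LinearMap.smul_apply, Pi.smul_apply, hTR, smul_eq_mul, ← Complex.ofReal_mul,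
      inv_mul_eq_div]
    simp [wt, Pi.single_apply]
  · rw [LinearMap.smul_comp, LinearMap.comp_smul, hT]
  · have h1 := coupling_orthogonal ht ht' hT m m'
    simp only [hTR] at h1
    have h2 : ∑ p, ∑ n, R p n m * R p n m' =
        if m = m' then ∑ p, ∑ n, R p n 0 * R p n 0 else 0 := by
      split_ifs at h1 ⊢
      · exact_mod_cast h1
      · exact_mod_cast h1
    rw [hsum] at h2
    have h3 : ∑ p, ∑ n, R p n m / α * (R p n m' / α) =
        (∑ p, ∑ n, R p n m * R p n m') / α ^ 2 := by
      rw [Finset.sum_div]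
      refine Finset.sum_congr rfl fun p _ => ?_
      rw [Finset.sum_div]
      refine Finset.sum_congr rfl fun n _ => ?_
      rw [div_mul_div_comm, pow_two]
    rw [h3, h2]
    split_ifs
    · exact div_self (by positivity)
    · exact zero_div _
  · have hnl : (n : ℕ) = l := by omega
    have h1 : R 0 n 0 = β := by
      have e1 := hTR 0 n 0
      rw [wt_eq_wv, wt_eq_wv, hnl, Fin.val_zero, htop] at e1
      exact (Complex.ofReal_injective e1).symm
    rw [h1, hnl, mul_div_assoc', hβ, ← mul_assoc]
    refine div_pos (mul_pos ?_ (prod_ladder_pos ht ht' hl)) hα0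
    have h0 : (t : ℝ) ≠ 0 := t.ne_zero
    rw [← zpow_natCast, ← zpow_add₀ h0]
    refine Even.zpow_pos ?_ h0
    -- The total exponent `l(l+1)` is even, so the phase is right for negative `t` as well.
    have e2 : (((l * (N + 1 - l) : ℕ) : ℤ) + -(l * ((N : ℤ) - 2 * l))) = l * (l + 1) := by
      push_cast [Nat.cast_sub (show l ≤ N + 1 by omega)]
      ring
    rw [e2]
    exact Int.even_mul_succ_self l

/-- The operators `π^j(λ^l_p)` vanish for `l > 2j`. -/
lemma matEl_lam_eq_zero {t : ℝˣ} (ht : t ≠ 1) (ht' : t ≠ -1) {l N : ℕ} (h : N < l)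
    (p : Fin (2 * l + 1)) (m n : Fin (N + 1)) : matEl t N (lam t l p) m n = 0 := by
  have h0 : lamAct t l N = 0 := coupling_eq_zero ht ht' (lamAct_intertwines ht ht' l N)
    (d := l) (by omega) (by rw [wv_of_lt h, TensorProduct.tmul_zero, map_zero, Pi.zero_apply])
  rw [matEl, ← lamMap_wt, ← lamAct_tmul, h0, LinearMap.zero_apply, Pi.zero_apply]

end QuantumSU2

end

/-! ### The matrix elements as Clebsch–Gordan coefficients -/

theorem proposition4 (t : ℝˣ) (ht : t ≠ 1) (ht' : t ≠ -1) (l N : ℕ) :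
    LinearIndependent ℂ (QuantumSU2.lam t l) ∧
    HopfRep.IsIrreducibleTensorOperator (HopfRep.ad (QuantumSU2.U t)) (QuantumSU2.Ul t l)
      (QuantumSU2.irrep t N) (QuantumSU2.irrep t N)
      ((QuantumSU2.irrep t N).toLinearMap.domRestrict (QuantumSU2.Ul t l)) ∧
    (l ≤ N → ∀ (p : Fin (2 * l + 1)) (m n : Fin (N + 1)),
      QuantumSU2.matEl t N (QuantumSU2.lam t l p) m n =
        ((QuantumSU2.reducedMatrixElement t l N * QuantumSU2.cg t (2 * l) N N p n m : ℝ) : ℂ)) ∧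
    (N < l → ∀ (p : Fin (2 * l + 1)) (m n : Fin (N + 1)),
      QuantumSU2.matEl t N (QuantumSU2.lam t l p) m n = 0 ∧
        QuantumSU2.cg t (2 * l) N N p n m = 0) := by
  open QuantumSU2 in
  refine ⟨linearIndependent_lam ht ht' l, isIrreducibleTensorOperator_irrep ht ht' l N,
    fun hl p m n => ?_, fun hl p m n => ⟨matEl_lam_eq_zero ht ht' hl p m n, ?_⟩⟩
  · choose R hR using fun (p : Fin (2 * l + 1)) (n m : Fin (N + 1)) =>
      mem_realElements.1 (lam_mem_realElements t N l p) m n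
    have hC := isClebschGordan_matEl ht ht' hl hR
    have hcg : cg t (2 * l) N N = _ := dif_pos ⟨_, hC⟩
    -- `cg` is an arbitrary choice among the admissible families; uniqueness identifies it with the
    -- matrix elements divided by `α`.
    have h := hC.unique ht ht' (d := l) (by omega) (Exists.choose_spec ⟨_, hC⟩)
    rw [hR, hcg, ← h, mul_div_cancel₀ _ (reducedMatrixElement_pos ht ht' l N).ne']
  -- For `l > N` no admissible family exists, so `cg` takes its default value zero.
  · have hcg : cg t (2 * l) N N = 0 := dif_neg fun ⟨C, hC⟩ =>
      absurd (hC.le_right ht ht' (d := l) (by omega)) (by omega)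
    rw [hcg]
    rfl
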